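/- The model of computation is the deterministic multi-tape Turing machine with input alphabet $\{0,1\}$. A *proper complexity function* is a non-decreasing function $f:\mathbb{N}\to\mathbb{N}$ for which there is a multi-tape Turing machine with read-only input that, on every input $w\in\{0,1\}^*$, computes the string $1^{f(|w|)}$ in $O(|w|+f(|w|))$ steps and uses $O(f(|w|))$ space besides its input. A set $S\subseteq\{0,1\}^*$ is *generic* if $$\lim_{n\to\infty}\frac{|S\cap B_n|}{|B_n|}=1,\qquad B_n=\{w\in\{0,1\}^* : |w|\le n\}.$$ A language $L$ is *computable in time* $T(n)$ if some machine halts on every word $w\in\{0,1\}^*$ with the correct decision on whether $w\in L$, and does so within $T(|w|)$ steps for all words $w$ with at most finitely many exceptions. It is *generically computable in time* $T(n)$ if there is a machine $M$ for which the set of words $w$ such that $M$, on input $w$, halts within $T(|w|)$ steps with the correct decision on whether $w\in L$ is generic; nothing is required of $M$ on other words. **Theorem 9.3.** Let $f$ be a proper complexity function with $f(n)\ge n$ for all $n$. Then there is a language $L\subseteq\{0,1\}^*$ that is computable in time $f(n)^3$ but, for every constant $C\in\mathbb{N}$, is not generically computable in time $C\,f(n)$. In particular, $L$ is not generically computable in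 time $f(n)$. -/

import Mathlib

open Filter Topology

/-- Tape symbols over a set `A` of auxiliary symbols: the blank, the two letters of `{0,1}`
(`bit false` is `0`, `bit true` is `1`), and the auxiliary symbols. -/
inductive TapeSym (A : Type) : Type
  | blank : TapeSym A
  | bit (b : Bool) : TapeSym A
  | aux (a : A) : TapeSym A

/-- Head moves. -/
inductive HeadMove : Type
  | left
  | stay
  | right

/-- The displacement of the head for each move. -/
def HeadMove.toInt : HeadMove → ℤ
  | .left => -1
  | .stay => 0
  | .right => 1

/-- Control states over a set `Q` of working states: a working state, or one of the three
halting states "yes" (accept), "no" (reject) and "h" (halt with output, no decision). -/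
inductive Ctrl (Q : Type) : Type
  | work (q : Q) : Ctrl Q
  | yes : Ctrl Q
  | no : Ctrl Q
  | halt : Ctrl Q

/-- A deterministic multi-tape Turing machine with input alphabet `{0,1}`. It has `k + 1` tapes,
infinite in both directions: tape `0` is the input tape, the last tape is the output tape when
the machine computes a function. The transition function maps a working state and the scanned
symbols to the next control state and, for each tape, the symbol written and the head move. -/
structure MultitapeTM : Type 1 where
  k : ℕ
  A : Type
  finite_A : Finite A
  Q : Type
  finite_Q : Finite Q
  start : Q
  δ : Q → (Fin (k + 1) → TapeSym A) → Ctrl Q × (Fin (k + 1) → TapeSym A × HeadMove)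

namespace MultitapeTM

/-- A configuration: control state, contents of all tapes, positions of all heads. -/
structure Config (M : MultitapeTM) : Type where
  state : Ctrl M.Q
  tape : Fin (M.k + 1) → ℤ → TapeSym M.A
  head : Fin (M.k + 1) → ℤ

/-- The tape holding the word `w` in the cells `0, …, |w| - 1`, blank elsewhere. -/
def wordTape {A : Type} (w : List Bool) : ℤ → TapeSym A
  | Int.ofNat n => (w[n]?).elim TapeSym.blank TapeSym.bit
  | Int.negSucc _ => TapeSym.blank

/-- The initial configuration on input `w`. -/
def init (M : MultitapeTM) (w : List Bool) : M.Config where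
  state := .work M.start
  tape := fun i => if i = 0 then wordTape w else wordTape []
  head := fun _ => 0

/-- One step of computation; a halted configuration does not change. -/
def step (M : MultitapeTM) (c : M.Config) : M.Config :=
  match c.state with
  | .work q =>
    let r := M.δ q (fun i => c.tape i (c.head i))
    { state := r.1
      tape := fun i => Function.update (c.tape i) (c.head i) (r.2 i).1
      head := fun i => c.head i + (r.2 i).2.toInt }
  | _ => c

/-- The configuration after `t` steps on input `w`. -/
def run (M : MultitapeTM) (w : List Bool) (t : ℕ) : M.Config :=
  M.step^[t] (M.init w)

/-- `M` accepts `w` in at most `t` steps. -/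
def AcceptsIn (M : MultitapeTM) (w : List Bool) (t : ℕ) : Prop :=
  (M.run w t).state = .yes

/-- `M` rejects `w` in at most `t` steps. -/
def RejectsIn (M : MultitapeTM) (w : List Bool) (t : ℕ) : Prop :=
  (M.run w t).state = .no

/-- On input `w`, `M` halts after at most `t` steps with the correct decision on whether
`w` belongs to `L`. -/
def DecidesIn (M : MultitapeTM) (L : Language Bool) (w : List Bool) (t : ℕ) : Prop :=
  (w ∈ L ∧ M.AcceptsIn w t) ∨ (w ∉ L ∧ M.RejectsIn w t)

/-- On input `w`, `M` halts after at most `t` steps with the word `u` on its output tape. -/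
def OutputsIn (M : MultitapeTM) (w u : List Bool) (t : ℕ) : Prop :=
  (M.run w t).state = .halt ∧ (M.run w t).tape (Fin.last M.k) = wordTape u

/-- The input is read-only: `M` never changes a symbol on tape `0`, and its input head never
leaves the input word and the two blank cells next to it. -/
def ReadOnlyInput (M : MultitapeTM) : Prop :=
  (∀ q σ, ((M.δ q σ).2 0).1 = σ 0) ∧
    ∀ w t, -1 ≤ (M.run w t).head 0 ∧ (M.run w t).head 0 ≤ (w.length : ℤ)

/-- The space used besides the input in the first `t` steps on input `w`: the total number of
cells visited on the tapes other than the input tape. -/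
def spaceUsed (M : MultitapeTM) (w : List Bool) (t : ℕ) : ℕ :=
  ∑ i : Fin M.k, ((Finset.range (t + 1)).image fun s => (M.run w s).head i.succ).card

end MultitapeTM

/-- `f` is a proper complexity function: it is non-decreasing, and some multi-tape Turing
machine with read-only input computes, on every input `w`, the string `1^{f(|w|)}` in
`O(|w| + f(|w|))` steps, using `O(f(|w|))` space besides its input. -/
def IsProperComplexity (f : ℕ → ℕ) : Prop :=
  Monotone f ∧ ∃ (M : MultitapeTM) (c : ℕ), M.ReadOnlyInput ∧ ∀ w : List Bool,
    ∃ t ≤ c * (w.length + f w.length) + c,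
      M.OutputsIn w (List.replicate (f w.length) true) t ∧
        M.spaceUsed w t ≤ c * f w.length + c

/-- `L` is computable in deterministic time `T(n)`: some machine decides every word correctly,
within `T(|w|)` steps for all words `w` with at most finitely many exceptions. -/
def ComputableInTime (L : Language Bool) (T : ℕ → ℕ) : Prop :=
  ∃ M : MultitapeTM, (∀ w, ∃ t, M.DecidesIn L w t) ∧
    ∃ N : ℕ, ∀ w : List Bool, N ≤ w.length → M.DecidesIn L w (T w.length)

/-- The ball `B_n` of all words of length at most `n`. -/
def wordBall (n : ℕ) : Set (List Bool) := {w | w.length ≤ n}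

/-- The proportion `ρ_n(S) = |S ∩ B_n| / |B_n|`. -/
noncomputable def wordDensity (S : Set (List Bool)) (n : ℕ) : ℝ :=
  ((S ∩ wordBall n).ncard : ℝ) / ((wordBall n).ncard : ℝ)

/-- `S` is generic: its asymptotic density `lim ρ_n(S)` exists and equals `1`. -/
def IsGeneric (S : Set (List Bool)) : Prop :=
  Tendsto (wordDensity S) atTop (𝓝 1)

/-- `L` is generically computable in time `T(n)`: for some machine, the set of words `w` whose
membership in `L` it decides correctly within `T(|w|)` steps is generic. Nothing is required
of the machine on other words. -/
def GenericallyComputableInTime (L : Language Bool) (T : ℕ → ℕ) : Prop :=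
  ∃ M : MultitapeTM, IsGeneric {w | M.DecidesIn L w (T w.length)}

/-! Diagonalization. Fix a self-delimiting encoding of machines, and let `L` contain `u ++ v`, where
`u` encodes `M'`, exactly when `M'` rejects `u ++ v` in the time allowed by a clock. If `M'` decided
`L` generically in time `C * f n`, it would be wrong on all long words `u ++ v`, and these have
density at least `1 / 2 ^ (|u| + 1)` in every large ball.

Two simulations make this quantitative. A machine `M'` with any number of tapes and symbols is
simulated on a single work tape of bits by sweeping back and forth over the visited cells, so that
`t` steps cost `O(t ^ 2)`; programs of such sweeping machines are interpreted with constant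
overhead. The clock runs the machine that computes `1 ^ f n` and counts its steps, writing one
mark for every `d + 1` of them, and then lets three heads bounce between the ends of the resulting
block of marks like the digits of an odometer. It stops after a cubic number of steps: enough for
the quadratic simulation of `C * f n` steps, yet at most `f n ^ 3` when `d` is large. -/

/-! ### Tapes seen from the head -/

section Tape

variable {Γ : Type}

/-- The tape `T` with its cells renumbered so that cell `x` becomes cell `0`. -/
def shiftTape (T : ℤ → Γ) (x : ℤ) : ℤ → Γ := fun z => T (x + z)

@[simp] theorem shiftTape_apply_zero (T : ℤ → Γ) (x : ℤ) : shiftTape T x 0 = T x := by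
  simp [shiftTape]

@[simp] theorem shiftTape_zero (T : ℤ → Γ) : shiftTape T 0 = T := by
  funext z; simp [shiftTape]

theorem shiftTape_shiftTape (T : ℤ → Γ) (x y : ℤ) :
    shiftTape (shiftTape T x) y = shiftTape T (x + y) := by
  funext z; simp [shiftTape, add_assoc]

theorem update_shiftTape (T : ℤ → Γ) (x : ℤ) (a : Γ) :
    Function.update (shiftTape T x) 0 a = shiftTape (Function.update T x a) x := by
  funext z; simp [shiftTape, Function.update_apply]

/-- Write `a` in the scanned cell, then move the head. The cells of a tape seen from the head are
numbered so that the head always scans cell `0`. -/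
def act (T : ℤ → Γ) (a : Γ) (m : HeadMove) : ℤ → Γ :=
  shiftTape (Function.update T 0 a) m.toInt

theorem act_shiftTape (T : ℤ → Γ) (x : ℤ) (a : Γ) (m : HeadMove) :
    act (shiftTape T x) a m = shiftTape (Function.update T x a) (x + m.toInt) := by
  rw [act, update_shiftTape, shiftTape_shiftTape]

theorem act_shiftTape_self (T : ℤ → Γ) (x : ℤ) (m : HeadMove) :
    act (shiftTape T x) (T x) m = shiftTape T (x + m.toInt) := by
  rw [act_shiftTape, Function.update_eq_self]

theorem act_stay_self (T : ℤ → Γ) : act T (T 0) .stay = T := by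
  simp [act, HeadMove.toInt]

theorem act_comp {Δ : Type} (g : Γ → Δ) (T : ℤ → Γ) (a : Γ) (m : HeadMove) :
    act (g ∘ T) (g a) m = g ∘ act T a m := by
  rw [act, ← Function.comp_update]; rfl

end Tape

section SplitTape

variable {Γ : Type} [Inhabited Γ]

/-- The tape with `L` to the left of the head (nearest cell first) and `R` from the head on. -/
def splitTape (L R : List Γ) : ℤ → Γ
  | Int.ofNat n => R.getD n default
  | Int.negSucc n => L.getD n default

@[simp] theorem splitTape_zero (L R : List Γ) : splitTape L R 0 = R.headD default := by
  cases R <;> rfl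

theorem update_splitTape (L R : List Γ) (a : Γ) :
    Function.update (splitTape L R) 0 a = splitTape L (a :: R.tail) := by
  funext z
  rcases z with (_ | n) | n
  · simp [splitTape]
  · rw [Function.update_of_ne (by simp; omega)]
    cases R <;> simp [splitTape]
  · rfl

theorem shiftTape_splitTape_one (L R : List Γ) :
    shiftTape (splitTape L R) 1 = splitTape (R.headD default :: L) R.tail := by
  funext z
  rcases z with n | _ | n
  · rw [shiftTape, Int.ofNat_eq_natCast, show (1 : ℤ) + n = Int.ofNat (n + 1) by simp; omega]
    cases R <;> simp [splitTape]
  · cases R <;> rfl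
  · rw [shiftTape, show (1 : ℤ) + Int.negSucc (n + 1) = Int.negSucc n by omega]
    simp [splitTape]

theorem shiftTape_splitTape_neg_one (L R : List Γ) :
    shiftTape (splitTape L R) (-1) = splitTape L.tail (L.headD default :: R) := by
  funext z
  rcases z with (_ | n) | n
  · cases L <;> rfl
  · rw [shiftTape, show (-1 : ℤ) + Int.ofNat (n + 1) = Int.ofNat n by simp]
    simp [splitTape]
  · rw [shiftTape, show (-1 : ℤ) + Int.negSucc n = Int.negSucc (n + 1) by omega]
    cases L <;> simp [splitTape]

theorem act_splitTape_right (L R : List Γ) (a : Γ) :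
    act (splitTape L R) a .right = splitTape (a :: L) R.tail := by
  rw [act, update_splitTape]
  exact shiftTape_splitTape_one L (a :: R.tail)

theorem act_splitTape_stay (L R : List Γ) (a : Γ) :
    act (splitTape L R) a .stay = splitTape L (a :: R.tail) := by
  rw [act, update_splitTape, HeadMove.toInt, shiftTape_zero]

theorem act_splitTape_left (L R : List Γ) (a : Γ) :
    act (splitTape L R) a .left = splitTape L.tail (L.headD default :: a :: R.tail) := by
  rw [act, update_splitTape]
  exact shiftTape_splitTape_neg_one L (a :: R.tail)

theorem splitTape_append_default (L R : List Γ) :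
    splitTape L (R ++ [default]) = splitTape L R := by
  funext z
  rcases z with n | n
  · rw [splitTape, splitTape]
    rcases lt_or_ge n R.length with h | h
    · rw [List.getD_append _ _ _ _ h]
    · rw [List.getD_append_right _ _ _ _ h, List.getD_eq_default _ _ h]
      cases n - R.length <;> simp
  · rfl

theorem splitTape_left_default (R : List Γ) : splitTape [default] R = splitTape [] R := by
  funext z
  rcases z with n | _ | n <;> rfl

theorem splitTape_right_default (L : List Γ) : splitTape L [default] = splitTape L [] :=
  splitTape_append_default L []

/-- The tape on which a head sweeping right (`d = true`) or left (`d = false`) has passed the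
cells `P` (latest first), and has the cells `R` ahead of it. -/
def sweepTape (d : Bool) (P R : List Γ) : ℤ → Γ :=
  if d then splitTape P R else splitTape R.tail (R.headD default :: P)

/-- The move of a head sweeping right (`d = true`) or left (`d = false`). -/
def sweepMove (d : Bool) : HeadMove := if d then .right else .left

@[simp] theorem sweepTape_zero (d : Bool) (P R : List Γ) :
    sweepTape d P R 0 = R.headD default := by
  cases d <;> simp [sweepTape]

theorem act_sweepTape (d : Bool) (P R : List Γ) (a : Γ) :
    act (sweepTape d P R) a (sweepMove d) = sweepTape d (a :: P) R.tail := by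
  cases d
  · simp [sweepTape, sweepMove, act_splitTape_left]
  · simp [sweepTape, sweepMove, act_splitTape_right]

theorem act_sweepTape_turn (d : Bool) (P : List Γ) :
    act (sweepTape d P []) default (sweepMove !d) = sweepTape (!d) [] P := by
  cases d
  · simp [sweepTape, sweepMove, act_splitTape_right, splitTape_left_default]
  · simpa [sweepTape, sweepMove, act_splitTape_left] using
      splitTape_append_default P.tail [P.headD default]

end SplitTape

instance {A : Type} : Inhabited (TapeSym A) := ⟨.blank⟩

theorem TapeSym.default_eq {A : Type} : (default : TapeSym A) = .blank := rfl

namespace MultitapeTM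

theorem wordTape_natCast {A : Type} (w : List Bool) (n : ℕ) :
    (wordTape w (n : ℤ) : TapeSym A) = (w[n]?).elim TapeSym.blank TapeSym.bit := rfl

theorem wordTape_of_neg {A : Type} (w : List Bool) {z : ℤ} (hz : z < 0) :
    (wordTape w z : TapeSym A) = TapeSym.blank := by
  obtain ⟨n, rfl⟩ := Int.eq_negSucc_of_lt_zero hz
  rfl

theorem wordTape_of_length_le {A : Type} (w : List Bool) {z : ℤ} (hz : (w.length : ℤ) ≤ z) :
    (wordTape w z : TapeSym A) = TapeSym.blank := by
  obtain ⟨n, rfl⟩ := Int.eq_ofNat_of_zero_le (by omega : 0 ≤ z)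
  rw [wordTape_natCast, List.getElem?_eq_none (by omega), Option.elim_none]

theorem wordTape_nil {A : Type} (z : ℤ) : (wordTape [] z : TapeSym A) = .blank := by
  cases z <;> rfl

theorem wordTape_eq_splitTape {A : Type} (w : List Bool) :
    (wordTape w : ℤ → TapeSym A) = splitTape [] (w.map .bit) := by
  funext z
  rcases z with n | n
  · rw [wordTape, splitTape, List.getD_eq_getElem?_getD, List.getElem?_map]
    cases w[n]? <;> rfl
  · rfl

theorem update_wordTape {A : Type} (u : List Bool) (b : Bool) :
    Function.update (wordTape u : ℤ → TapeSym A) u.length (.bit b) = wordTape (u ++ [b]) := by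
  funext z
  rcases z with n | n
  · by_cases h : n = u.length
    · subst h; simp [wordTape]
    · rw [Function.update_of_ne (by simpa using h), wordTape, wordTape, List.getElem?_append]
      split_ifs with hn
      · rfl
      · rw [List.getElem?_eq_none (by omega), List.getElem?_eq_none (by simp; omega)]
  · rfl

theorem act_shiftTape_wordTape {A : Type} (u : List Bool) (b : Bool) :
    act (shiftTape (wordTape u : ℤ → TapeSym A) u.length) (.bit b) .right =
      shiftTape (wordTape (u ++ [b])) ((u.length : ℤ) + 1) := by
  rw [act_shiftTape, update_wordTape]; rfl

end MultitapeTM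

/-! ### Machines acting on tapes seen from the head -/

section Iterate

variable {α : Type*} {f : α → α} {P : α → Prop} {x : α} {s t : ℕ}

theorem iterate_eq_of_not (hf : ∀ y, ¬ P y → f y = y) (h : ¬ P (f^[s] x)) (hst : s ≤ t) :
    f^[t] x = f^[s] x := by
  obtain ⟨u, rfl⟩ := Nat.exists_eq_add_of_le' hst
  rw [Function.iterate_add_apply, Function.iterate_fixed (hf _ h)]

theorem prop_iterate_of_le (hf : ∀ y, ¬ P y → f y = y) (h : P (f^[t] x)) (hst : s ≤ t) :
    P (f^[s] x) := by
  by_contra hs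
  exact hs (iterate_eq_of_not hf hs hst ▸ h)

theorem exists_last_prop_iterate (hx : P x) (h : ¬ P (f^[t] x)) :
    ∃ s < t, P (f^[s] x) ∧ ¬ P (f^[s + 1] x) := by
  induction t with
  | zero => exact absurd hx h
  | succ t ih =>
    by_cases ht : P (f^[t] x)
    · exact ⟨t, by omega, ht, h⟩
    · obtain ⟨s, hs, h'⟩ := ih ht
      exact ⟨s, by omega, h'⟩

theorem iterate_trans {y z : α} (h₁ : f^[s] x = y) (h₂ : f^[t] y = z) : f^[t + s] x = z := by
  rw [Function.iterate_add_apply, h₁, h₂]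

end Iterate

/-- The control state is a working state. -/
def Ctrl.IsWork {Q : Type} (s : Ctrl Q) : Prop := ∃ q, s = .work q

/-- The control state that accepts (`true`) or rejects (`false`). -/
def Ctrl.answer {Q : Type} : Bool → Ctrl Q
  | true => .yes
  | false => .no

theorem Ctrl.not_isWork_answer {Q : Type} (b : Bool) : ¬ (Ctrl.answer b : Ctrl Q).IsWork := by
  rintro ⟨q, hq⟩
  cases b <;> cases hq

theorem Ctrl.answer_injective {Q : Type} : Function.Injective (Ctrl.answer : Bool → Ctrl Q) := by
  rintro (_ | _) (_ | _) h <;> first | rfl | cases h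

/-- A transition function with states `Q`, tapes `ι` and auxiliary symbols `A`. -/
abbrev TransFun (Q ι A : Type) : Type :=
  Q → (ι → TapeSym A) → Ctrl Q × (ι → TapeSym A × HeadMove)

/-- A control state together with the tapes as seen from their heads. -/
abbrev ViewConfig (Q ι A : Type) : Type := Ctrl Q × (ι → ℤ → TapeSym A)

section ViewStep

variable {Q ι A : Type}

/-- One step of computation on tapes seen from the head. -/
def viewStep (δ : TransFun Q ι A) (c : ViewConfig Q ι A) : ViewConfig Q ι A :=
  match c.1 with
  | .work q =>
    ((δ q fun i => c.2 i 0).1,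
      fun i => act (c.2 i) ((δ q fun i => c.2 i 0).2 i).1 ((δ q fun i => c.2 i 0).2 i).2)
  | _ => c

/-- Started in `c`, the machine answers `b` within `t` steps. -/
def AnswersWithin (δ : TransFun Q ι A) (c : ViewConfig Q ι A) (t : ℕ) (b : Bool) : Prop :=
  ((viewStep δ)^[t] c).1 = .answer b

/-- Started in `c`, the machine is working at time `t` and has halted at time `t + 1`. -/
def LastStepAt (δ : TransFun Q ι A) (c : ViewConfig Q ι A) (t : ℕ) : Prop :=
  ((viewStep δ)^[t] c).1.IsWork ∧ ¬ ((viewStep δ)^[t + 1] c).1.IsWork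

variable (δ : TransFun Q ι A)

theorem viewStep_work (q : Q) (T : ι → ℤ → TapeSym A) :
    viewStep δ (.work q, T) =
      ((δ q fun i => T i 0).1,
        fun i => act (T i) ((δ q fun i => T i 0).2 i).1 ((δ q fun i => T i 0).2 i).2) := rfl

theorem viewStep_of_not_isWork (c : ViewConfig Q ι A) (h : ¬ c.1.IsWork) : viewStep δ c = c := by
  rcases c with ⟨_ | _ | _ | _, T⟩
  · exact absurd ⟨_, rfl⟩ h
  all_goals rfl

variable {δ} {c : ViewConfig Q ι A} {s t : ℕ}

theorem viewStep_iterate_eq_of_le (h : ¬ ((viewStep δ)^[s] c).1.IsWork) (hst : s ≤ t) :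
    (viewStep δ)^[t] c = (viewStep δ)^[s] c :=
  iterate_eq_of_not (viewStep_of_not_isWork δ) h hst

theorem isWork_of_le (h : ((viewStep δ)^[t] c).1.IsWork) (hst : s ≤ t) :
    ((viewStep δ)^[s] c).1.IsWork :=
  prop_iterate_of_le (P := fun c : ViewConfig Q ι A => c.1.IsWork) (viewStep_of_not_isWork δ) h hst

theorem exists_lastStepAt (h₀ : c.1.IsWork) (h : ¬ ((viewStep δ)^[t] c).1.IsWork) :
    ∃ s < t, LastStepAt δ c s :=
  exists_last_prop_iterate (P := fun c : ViewConfig Q ι A => c.1.IsWork) h₀ h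

theorem AnswersWithin.not_isWork {b : Bool} (h : AnswersWithin δ c t b) :
    ¬ ((viewStep δ)^[t] c).1.IsWork := by
  rw [h]; exact Ctrl.not_isWork_answer b

theorem AnswersWithin.mono {b : Bool} (h : AnswersWithin δ c s b) (hst : s ≤ t) :
    AnswersWithin δ c t b := by
  rw [AnswersWithin, viewStep_iterate_eq_of_le h.not_isWork hst, h]

theorem AnswersWithin.of_iterate {c' : ViewConfig Q ι A} {b : Bool}
    (hc : (viewStep δ)^[s] c = c') (h : AnswersWithin δ c' t b) : AnswersWithin δ c (t + s) b := by
  rw [AnswersWithin, iterate_trans hc rfl, h]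

theorem LastStepAt.of_iterate {c' : ViewConfig Q ι A} (hc : (viewStep δ)^[s] c = c')
    (h : LastStepAt δ c' t) : LastStepAt δ c (t + s) := by
  rw [LastStepAt, Nat.add_right_comm, iterate_trans hc rfl, iterate_trans hc rfl]
  exact h

end ViewStep

namespace MultitapeTM

/-- A configuration seen from the heads. -/
def Config.view {M : MultitapeTM} (c : M.Config) : ViewConfig M.Q (Fin (M.k + 1)) M.A :=
  (c.state, fun i => shiftTape (c.tape i) (c.head i))

theorem view_step (M : MultitapeTM) (c : M.Config) : (M.step c).view = viewStep M.δ c.view := by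
  rcases c with ⟨q | _ | _ | _, T, p⟩
  · simp only [step, Config.view, viewStep_work, shiftTape_apply_zero, act_shiftTape]
  all_goals rfl

theorem view_init (M : MultitapeTM) (w : List Bool) :
    (M.init w).view = (.work M.start, fun i => if i = 0 then wordTape w else wordTape []) := by
  simp [init, Config.view, shiftTape_zero]

theorem run_state (M : MultitapeTM) (w : List Bool) (t : ℕ) :
    (M.run w t).state = ((viewStep M.δ)^[t] (M.init w).view).1 :=
  congrArg Prod.fst
    ((Function.Semiconj.iterate_right (f := Config.view) (view_step M) t) (M.init w))

/-- On input `w`, the machine answers `b` within `t` steps. -/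
def AnswersWithin (M : MultitapeTM) (w : List Bool) (t : ℕ) (b : Bool) : Prop :=
  (M.run w t).state = .answer b

theorem answersWithin_iff {M : MultitapeTM} {w : List Bool} {t : ℕ} {b : Bool} :
    M.AnswersWithin w t b ↔ _root_.AnswersWithin M.δ (M.init w).view t b := by
  rw [AnswersWithin, run_state]; rfl

theorem AnswersWithin.mono {M : MultitapeTM} {w : List Bool} {s t : ℕ} {b : Bool}
    (h : M.AnswersWithin w s b) (hst : s ≤ t) : M.AnswersWithin w t b :=
  answersWithin_iff.2 ((answersWithin_iff.1 h).mono hst)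

/-- On input `w`, the machine is working at time `t` and has halted at time `t + 1`. -/
def LastStepAt (M : MultitapeTM) (w : List Bool) (t : ℕ) : Prop :=
  (M.run w t).state.IsWork ∧ ¬ (M.run w (t + 1)).state.IsWork

theorem lastStepAt_iff {M : MultitapeTM} {w : List Bool} {t : ℕ} :
    M.LastStepAt w t ↔ _root_.LastStepAt M.δ (M.init w).view t := by
  rw [LastStepAt, run_state, run_state]; rfl

theorem exists_lastStepAt {M : MultitapeTM} {w : List Bool} {t : ℕ}
    (h : ¬ (M.run w t).state.IsWork) : ∃ s < t, M.LastStepAt w s := by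
  simp only [lastStepAt_iff]
  rw [run_state] at h
  exact _root_.exists_lastStepAt ⟨M.start, rfl⟩ h

/-- The machine with a given transition function on tapes indexed by `ι`. -/
def ofTrans {Q ι A : Type} [hA : Finite A] [hQ : Finite Q] {k : ℕ} (e : ι ≃ Fin (k + 1)) (q₀ : Q)
    (δ : TransFun Q ι A) : MultitapeTM where
  k := k
  A := A
  finite_A := hA
  Q := Q
  finite_Q := hQ
  start := q₀
  δ := fun q σ => ((δ q (σ ∘ e)).1, (δ q (σ ∘ e)).2 ∘ e.symm)

theorem run_ofTrans_state {Q ι A : Type} [Finite A] [Finite Q] {k : ℕ} (e : ι ≃ Fin (k + 1))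
    (q₀ : Q) (δ : TransFun Q ι A) (w : List Bool) (t : ℕ) :
    ((ofTrans e q₀ δ).run w t).state = ((viewStep δ)^[t]
      (.work q₀, fun i => if e i = 0 then wordTape w else wordTape [])).1 := by
  let F : ViewConfig Q (Fin (k + 1)) A → ViewConfig Q ι A := fun c => (c.1, c.2 ∘ e)
  have hF : Function.Semiconj F (viewStep (ofTrans e q₀ δ).δ) (viewStep δ) := by
    rintro ⟨_ | _ | _ | _, T⟩
    · refine Prod.ext rfl (funext fun i => ?_)
      simp [F, viewStep_work, ofTrans, Function.comp_def]
    all_goals rfl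
  have h := congrArg Prod.fst (hF.iterate_right t ((ofTrans e q₀ δ).init w).view)
  rw [run_state]
  rw [view_init] at h ⊢
  exact h

end MultitapeTM

theorem exists_equiv_fin_map_zero {α : Type*} [Finite α] (a : α) :
    ∃ (n : ℕ) (e : α ≃ Fin (n + 1)), e a = 0 := by
  obtain ⟨n, ⟨e⟩⟩ := Finite.exists_equiv_fin α
  cases n with
  | zero => exact (e a).elim0
  | succ n => exact ⟨n, e.trans (Equiv.swap (e a) 0), by simp⟩

/-! ### The interpreter -/

/-- The letter on a tape cell, if there is one. -/
def TapeSym.toOption {A : Type} : TapeSym A → Option Bool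
  | .bit b => some b
  | _ => none

/-- The symbol for a letter or a blank. -/
def TapeSym.ofOption {A : Type} : Option Bool → TapeSym A
  | some b => .bit b
  | none => .blank

@[simp] theorem TapeSym.toOption_ofOption {A : Type} (x : Option Bool) :
    (TapeSym.ofOption x : TapeSym A).toOption = x := by
  cases x <;> rfl

theorem MultitapeTM.toOption_wordTape {A : Type} (w : List Bool) (j : ℕ) :
    (wordTape w (j : ℤ) : TapeSym A).toOption = w[j]? := by
  rw [wordTape_natCast]
  cases w[j]? <;> rfl

/-- What an instruction does: answer, or write a symbol on the data tape, move its head, and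
possibly advance the input head. -/
abbrev Operation : Type := Bool ⊕ (Option Bool × HeadMove × Bool)

instance : Finite HeadMove :=
  Finite.of_surjective ![HeadMove.left, .stay, .right] (by
    rintro (_ | _ | _)
    exacts [⟨0, rfl⟩, ⟨1, rfl⟩, ⟨2, rfl⟩])

/-- The number of operations. -/
noncomputable def operationCount : ℕ := Nat.card Operation

/-- The code of an operation. -/
noncomputable def Operation.code : Operation ≃ Fin operationCount :=
  Finite.equivFin _

/-- The number selecting an instruction by the scanned input and data symbols. -/
noncomputable def symbolIndex : Option Bool × Option Bool ≃ Fin 9 :=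
  Fintype.equivFinOfCardEq rfl

/-- An instruction as a word: the index of the first instruction of the next state, and the code of
the operation, both in unary and terminated by `false`, so that programs are self-delimiting. -/
noncomputable def encodeEntry (r : ℕ × Operation) : List Bool :=
  List.replicate r.1 true ++ false :: (List.replicate (Operation.code r.2) true ++ [false])

/-- A program as a word. The instruction executed in the state with first instruction `m` is the one
with index `m + symbolIndex (x, d)`, where `x` and `d` are the scanned symbols. -/
noncomputable def encodeTable (tab : List (ℕ × Operation)) : List Bool := tab.flatMap encodeEntry

/-- The control states of the interpreter: it rewinds the program, skips instructions up to the
selected one, and reads the next state and the operation of that one. While skipping it remembers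
how many of the at most `9` instructions due to the scanned symbols are left. -/
inductive InterpState : Type
  | rewind
  | skip (e : Fin 10)
  | skipAddress (e : Fin 10)
  | skipOperation (e : Fin 10)
  | readAddress
  | readOperation (b : Fin (operationCount + 1))

instance : Finite InterpState :=
  Finite.of_surjective
    (fun x : Bool ⊕ (Fin 3 × Fin 10) ⊕ Fin (operationCount + 1) =>
      match x with
      | .inl false => InterpState.rewind
      | .inl true => .readAddress
      | .inr (.inl (0, e)) => .skip e
      | .inr (.inl (1, e)) => .skipAddress e
      | .inr (.inl (2, e)) => .skipOperation e
      | .inr (.inr b) => .readOperation b) (by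
    rintro (_ | e | e | e | _ | b)
    exacts [⟨.inl false, rfl⟩, ⟨.inr (.inl (0, e)), rfl⟩, ⟨.inr (.inl (1, e)), rfl⟩,
      ⟨.inr (.inl (2, e)), rfl⟩, ⟨.inl true, rfl⟩, ⟨.inr (.inr b), rfl⟩])

/-- The tapes of the interpreter: program, input, address register, data. The program is a prefix
of the input, so the first two hold the same word. -/
inductive InterpTape : Type
  | prog
  | inp
  | addr
  | dat

instance : Finite InterpTape :=
  Finite.of_surjective ![InterpTape.prog, .inp, .addr, .dat] (by
    rintro (_ | _ | _ | _)
    exacts [⟨0, rfl⟩, ⟨1, rfl⟩, ⟨2, rfl⟩, ⟨3, rfl⟩])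

/-- A function on the tapes of the interpreter, given by its values. -/
def onInterpTapes {α : Type} (p x a d : α) : InterpTape → α
  | .prog => p
  | .inp => x
  | .addr => a
  | .dat => d

section ReadUnary

theorem getElem?_of_drop_eq_cons {α : Type*} {w l : List α} {p : ℕ} {a : α}
    (h : w.drop p = a :: l) : w[p]? = some a := by
  rw [← List.head?_drop, h, List.head?_cons]

theorem drop_succ_of_drop_eq_cons {α : Type*} {w l : List α} {p : ℕ} {a : α}
    (h : w.drop p = a :: l) : w.drop (p + 1) = l := by
  rw [← List.tail_drop, h, List.tail_cons]

theorem drop_add_of_drop_eq_append {α : Type*} {w l l' : List α} {p : ℕ}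
    (h : w.drop p = l ++ l') : w.drop (p + l.length) = l' := by
  rw [← List.drop_drop, h, List.drop_left]

variable {α : Type*} {F : α → α} {g g' : ℕ → ℕ → α} {w rest : List Bool} {a p : ℕ}

theorem drop_add_of_drop_eq_unary (hw : w.drop p = List.replicate a true ++ rest) :
    w.drop (p + a) = rest := by
  simpa using drop_add_of_drop_eq_append hw

theorem iterate_of_drop_eq_unary
    (h1 : ∀ p i, w[p]? = some true → F (g p i) = g (p + 1) (i + 1))
    (hw : w.drop p = List.replicate a true ++ rest) (i : ℕ) :
    F^[a] (g p i) = g (p + a) (i + a) := by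
  induction a generalizing p i with
  | zero => rfl
  | succ a ih =>
    rw [List.replicate_succ, List.cons_append] at hw
    rw [Function.iterate_succ_apply, h1 p i (getElem?_of_drop_eq_cons hw),
      ih (drop_succ_of_drop_eq_cons hw), Nat.add_right_comm, Nat.add_right_comm i]
    rfl

theorem iterate_succ_of_drop_eq_unary
    (h1 : ∀ p i, w[p]? = some true → F (g p i) = g (p + 1) (i + 1))
    (h0 : ∀ p i, w[p]? = some false → F (g p i) = g' (p + 1) i)
    (hw : w.drop p = List.replicate a true ++ false :: rest) (i : ℕ) :
    F^[a + 1] (g p i) = g' (p + a + 1) (i + a) := by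
  rw [Function.iterate_succ_apply', iterate_of_drop_eq_unary h1 hw,
    h0 _ _ (getElem?_of_drop_eq_cons (drop_add_of_drop_eq_unary hw))]

end ReadUnary

section Interpreter

variable {A : Type}

/-- The transition function of the interpreter. Letters read from the program select the case. -/
noncomputable def interpTrans : TransFun InterpState InterpTape A := fun q σ =>
  let go (s : Ctrl InterpState) (m : HeadMove) (a : TapeSym A × HeadMove) :=
    (s, onInterpTapes (σ .prog, m) (σ .inp, .stay) a (σ .dat, .stay))
  let same : TapeSym A × HeadMove := (σ .addr, .stay)
  match q, (σ .prog).toOption with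
  | .rewind, some _ => go (.work .rewind) .left same
  | .rewind, none =>
      go (.work (.skip (symbolIndex ((σ .inp).toOption, (σ .dat).toOption)).castSucc)) .right same
  | .skip e, _ =>
      if e = 0 then
        if (σ .addr).toOption = none then go (.work .readAddress) .stay same
        else go (.work (.skipAddress 0)) .stay (.blank, .right)
      else go (.work (.skipAddress (e - 1))) .stay same
  | .skipAddress e, some true => go (.work (.skipAddress e)) .right same
  | .skipAddress e, some false => go (.work (.skipOperation e)) .right same
  | .skipOperation e, some true => go (.work (.skipOperation e)) .right same
  | .skipOperation e, some false => go (.work (.skip e)) .right same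
  | .readAddress, some true => go (.work .readAddress) .right (.bit true, .left)
  | .readAddress, some false => go (.work (.readOperation 0)) .right (σ .addr, .right)
  | .readOperation b, some true => go (.work (.readOperation (b + 1))) .right same
  | .readOperation b, some false =>
      if h : b.val < operationCount then
        match Operation.code.symm ⟨b.val, h⟩ with
        | .inl v => go (Ctrl.answer v) .stay same
        | .inr (a, m, adv) => (.work .rewind, onInterpTapes (σ .prog, .stay)
            (σ .inp, if adv then .right else .stay) same (.ofOption a, m))
      else go .halt .stay same
  | _, none => go .halt .stay same

/-- A configuration of the interpreter on the word `w`: program head at `p`, input head at `j`,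
address register `C`, data tape `D`. -/
def interpConfig (w : List Bool) (q : InterpState) (p : ℤ) (j : ℕ) (C : ℤ → TapeSym A)
    (D : ℤ → Option Bool) : ViewConfig InterpState InterpTape A :=
  (.work q, onInterpTapes (shiftTape (MultitapeTM.wordTape w) p)
    (shiftTape (MultitapeTM.wordTape w) j) C (TapeSym.ofOption ∘ D))

/-- The address register holding `m`. -/
def addressTape (m : ℕ) : ℤ → TapeSym A := splitTape [] (List.replicate m (.bit true))

/-- The address register while it is being loaded: the head is left of the `m` marks. -/
def loadingTape (m : ℕ) : ℤ → TapeSym A := splitTape [] (.blank :: List.replicate m (.bit true))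

theorem loadingTape_zero : (loadingTape 0 : ℤ → TapeSym A) = addressTape 0 :=
  splitTape_right_default []

theorem act_loadingTape_left (m : ℕ) :
    act (loadingTape m) (.bit true) .left = (loadingTape (m + 1) : ℤ → TapeSym A) := by
  simp [loadingTape, act_splitTape_left, List.replicate_succ, TapeSym.default_eq]

theorem act_loadingTape_right (m : ℕ) :
    act (loadingTape m) .blank .right = (addressTape m : ℤ → TapeSym A) := by
  rw [loadingTape, act_splitTape_right]
  exact splitTape_left_default _

theorem act_addressTape_right (m : ℕ) :
    act (addressTape (m + 1)) .blank .right = (addressTape m : ℤ → TapeSym A) := by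
  rw [addressTape, act_splitTape_right]
  exact splitTape_left_default _

/-- The initial configuration of the interpreter. -/
def interpStart (w : List Bool) : ViewConfig InterpState InterpTape A :=
  interpConfig w .rewind 0 0 (addressTape 0) fun _ => none

section Steps

variable {w : List Bool} {j : ℕ} {C : ℤ → TapeSym A} {D : ℤ → Option Bool} {q q' : InterpState}
  {m : HeadMove}

theorem viewStep_interpConfig {p : ℤ} {s : Ctrl InterpState} {adv : Bool}
    {a : TapeSym A × HeadMove} {d : Option Bool} {md : HeadMove}
    (h : interpTrans q (onInterpTapes (MultitapeTM.wordTape w p) (MultitapeTM.wordTape w j)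
        (C 0) (.ofOption (D 0))) =
      (s, onInterpTapes (MultitapeTM.wordTape w p, m)
        (MultitapeTM.wordTape w j, if adv then .right else .stay) a (.ofOption d, md))) :
    viewStep interpTrans (interpConfig w q p j C D) =
      (s, (interpConfig w q (p + m.toInt) (if adv then j + 1 else j) (act C a.1 a.2)
        (act D d md)).2) := by
  have hscan : (fun i => (interpConfig w q p j C D).2 i 0) =
      onInterpTapes (MultitapeTM.wordTape w p) (MultitapeTM.wordTape w j)
        (C 0) (TapeSym.ofOption (D 0)) := by
    funext i
    cases i <;> simp [interpConfig, onInterpTapes]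
  rw [show interpConfig w q p j C D = (.work q, (interpConfig w q p j C D).2) from rfl,
    viewStep_work, hscan, h]
  refine Prod.ext rfl (funext fun i => ?_)
  cases i
  · simp only [interpConfig, onInterpTapes, act_shiftTape_self]
  · simp only [interpConfig, onInterpTapes, act_shiftTape_self]
    cases adv <;> simp [HeadMove.toInt]
  · rfl
  · simp only [interpConfig, onInterpTapes, act_comp]

theorem viewStep_interpConfig_work {p : ℤ} {a : TapeSym A × HeadMove}
    (h : interpTrans q (onInterpTapes (MultitapeTM.wordTape w p) (MultitapeTM.wordTape w j)
        (C 0) (.ofOption (D 0))) =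
      (.work q', onInterpTapes (MultitapeTM.wordTape w p, m)
        (MultitapeTM.wordTape w j, .stay) a (.ofOption (D 0), .stay))) :
    viewStep interpTrans (interpConfig w q p j C D) =
      interpConfig w q' (p + m.toInt) j (act C a.1 a.2) D := by
  rw [viewStep_interpConfig (adv := false) h, act_stay_self]
  rfl

theorem viewStep_interpConfig_move {p : ℤ}
    (h : interpTrans q (onInterpTapes (MultitapeTM.wordTape w p) (MultitapeTM.wordTape w j)
        (C 0) (.ofOption (D 0))) =
      (.work q', onInterpTapes (MultitapeTM.wordTape w p, m)
        (MultitapeTM.wordTape w j, .stay) (C 0, .stay) (.ofOption (D 0), .stay))) :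
    viewStep interpTrans (interpConfig w q p j C D) = interpConfig w q' (p + m.toInt) j C D := by
  rw [viewStep_interpConfig_work h, act_stay_self]

theorem toOption_wordTape_of_getElem? {p : ℕ} {b : Bool} (hp : w[p]? = some b) :
    (MultitapeTM.wordTape w (p : ℤ) : TapeSym A).toOption = some b := by
  rw [MultitapeTM.toOption_wordTape, hp]

theorem interp_rewind {p : ℕ} (hp : p ≤ w.length) :
    (viewStep interpTrans)^[p] (interpConfig w .rewind (p - 1 : ℤ) j C D) =
      interpConfig w .rewind (-1) j C D := by
  induction p with
  | zero => rfl
  | succ p ih =>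
    have h : (MultitapeTM.wordTape w (p : ℤ) : TapeSym A).toOption = some w[p] :=
      toOption_wordTape_of_getElem? (by simp)
    rw [Function.iterate_succ_apply, Nat.cast_succ, add_sub_cancel_right,
      viewStep_interpConfig_move (q' := .rewind) (m := .left)
        (by simp only [interpTrans, onInterpTapes, h])]
    exact ih (by omega)

theorem interp_rewind_end :
    viewStep interpTrans (interpConfig w .rewind (-1) j C D) =
      interpConfig w (.skip (symbolIndex (w[j]?, D 0)).castSucc) 0 j C D := by
  have h : (MultitapeTM.wordTape w (-1) : TapeSym A).toOption = none := rfl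
  exact viewStep_interpConfig_move (m := .right) (by
    simp only [interpTrans, onInterpTapes, h, MultitapeTM.toOption_wordTape,
      TapeSym.toOption_ofOption])

theorem interp_skipAddress (e : Fin 10) {p : ℕ} {b : Bool} (hp : w[p]? = some b) :
    viewStep interpTrans (interpConfig w (.skipAddress e) p j C D) =
      interpConfig w (if b then .skipAddress e else .skipOperation e) (p + 1 : ℕ) j C D :=
  viewStep_interpConfig_move (m := .right) (by
    cases b <;> simp [interpTrans, onInterpTapes, toOption_wordTape_of_getElem? hp])

theorem interp_skipOperation (e : Fin 10) {p : ℕ} {b : Bool} (hp : w[p]? = some b) :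
    viewStep interpTrans (interpConfig w (.skipOperation e) p j C D) =
      interpConfig w (if b then .skipOperation e else .skip e) (p + 1 : ℕ) j C D :=
  viewStep_interpConfig_move (m := .right) (by
    cases b <;> simp [interpTrans, onInterpTapes, toOption_wordTape_of_getElem? hp])

theorem encodeEntry_append (r : ℕ × Operation) (rest : List Bool) :
    encodeEntry r ++ rest = List.replicate r.1 true ++
      false :: (List.replicate (Operation.code r.2) true ++ false :: rest) := by
  simp [encodeEntry]

theorem length_encodeEntry (r : ℕ × Operation) :
    (encodeEntry r).length = r.1 + (Operation.code r.2).val + 2 := by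
  simp only [encodeEntry, List.length_append, List.length_replicate, List.length_cons,
    List.length_nil]
  ring

theorem interp_skipEntry (e : Fin 10) {p : ℕ} {r : ℕ × Operation} {rest : List Bool}
    (hw : w.drop p = encodeEntry r ++ rest) :
    (viewStep interpTrans)^[(encodeEntry r).length] (interpConfig w (.skipAddress e) p j C D) =
      interpConfig w (.skip e) (p + (encodeEntry r).length : ℕ) j C D := by
  rw [encodeEntry_append] at hw
  have haddr := iterate_succ_of_drop_eq_unary (F := viewStep interpTrans)
    (g := fun p _ => interpConfig w (.skipAddress e) p j C D)
    (g' := fun p _ => interpConfig w (.skipOperation e) p j C D)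
    (fun p _ hp => interp_skipAddress e hp) (fun p _ hp => interp_skipAddress e hp) hw 0
  have hop := iterate_succ_of_drop_eq_unary (F := viewStep interpTrans)
    (g := fun p _ => interpConfig w (.skipOperation e) p j C D)
    (g' := fun p _ => interpConfig w (.skip e) p j C D)
    (fun p _ hp => interp_skipOperation e hp) (fun p _ hp => interp_skipOperation e hp)
    (drop_succ_of_drop_eq_cons (drop_add_of_drop_eq_unary hw)) 0
  rw [length_encodeEntry, show r.1 + (Operation.code r.2).val + 2 =
    (Operation.code r.2).val + 1 + (r.1 + 1) by ring, iterate_trans haddr hop]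
  congr 2
  ring

theorem interp_skip_succ {e : Fin 10} (he : e ≠ 0) (p : ℤ) :
    viewStep interpTrans (interpConfig w (.skip e) p j C D) =
      interpConfig w (.skipAddress (e - 1)) p j C D := by
  rw [viewStep_interpConfig_move (q' := .skipAddress (e - 1)) (m := .stay)
    (by simp [interpTrans, onInterpTapes, he]), HeadMove.toInt, add_zero]

theorem interp_skip_pop (m : ℕ) (p : ℤ) :
    viewStep interpTrans (interpConfig w (.skip 0) p j (addressTape (m + 1) : ℤ → TapeSym A) D) =
      interpConfig w (.skipAddress 0) p j (addressTape m) D := by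
  rw [viewStep_interpConfig_work (q' := .skipAddress 0) (m := .stay) (a := (.blank, .right))
    (by simp [interpTrans, onInterpTapes, addressTape, List.replicate_succ, TapeSym.toOption]),
    act_addressTape_right, HeadMove.toInt, add_zero]

theorem interp_skip_zero (p : ℤ) :
    viewStep interpTrans (interpConfig w (.skip 0) p j (addressTape 0 : ℤ → TapeSym A) D) =
      interpConfig w .readAddress p j (loadingTape 0) D := by
  rw [viewStep_interpConfig_move (q' := .readAddress) (m := .stay)
    (by simp [interpTrans, onInterpTapes, addressTape, TapeSym.default_eq, TapeSym.toOption]),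
    HeadMove.toInt, add_zero, loadingTape_zero]

theorem interp_readAddress {a p m : ℕ} {rest : List Bool}
    (hw : w.drop p = List.replicate a true ++ false :: rest) :
    (viewStep interpTrans)^[a + 1]
      (interpConfig w .readAddress p j (loadingTape m : ℤ → TapeSym A) D) =
      interpConfig w (.readOperation 0) (p + a + 1 : ℕ) j (addressTape (m + a)) D := by
  refine iterate_succ_of_drop_eq_unary (F := viewStep interpTrans)
    (g := fun p m => interpConfig w .readAddress p j (loadingTape m) D)
    (g' := fun p m => interpConfig w (.readOperation 0) p j (addressTape m) D)
    (fun p m hp => ?_) (fun p m hp => ?_) hw m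
  · rw [← act_loadingTape_left]
    exact viewStep_interpConfig_work (m := .right) (a := (.bit true, .left))
      (by simp [interpTrans, onInterpTapes, toOption_wordTape_of_getElem? hp])
  · rw [← act_loadingTape_right]
    exact viewStep_interpConfig_work (m := .right) (a := (.blank, .right))
      (by simp [interpTrans, onInterpTapes, toOption_wordTape_of_getElem? hp, loadingTape])

theorem interp_readOperation {a p : ℕ} {rest : List Bool}
    (hw : w.drop p = List.replicate a true ++ rest) :
    (viewStep interpTrans)^[a] (interpConfig w (.readOperation 0) p j C D) =
      interpConfig w (.readOperation (Fin.ofNat _ a)) (p + a : ℕ) j C D := by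
  have h := iterate_of_drop_eq_unary (F := viewStep interpTrans)
    (g := fun p b => interpConfig w (.readOperation (Fin.ofNat _ b)) p j C D)
    (fun p b hp => ?_) hw 0
  · rw [zero_add] at h
    exact h
  · have hb : (Fin.ofNat (operationCount + 1) (b + 1)) = Fin.ofNat _ b + 1 := by
      ext; simp [Fin.val_add]
    rw [hb]
    exact viewStep_interpConfig_move (m := .right)
      (by simp [interpTrans, onInterpTapes, toOption_wordTape_of_getElem? hp])

theorem ofNat_code (o : Operation) :
    Fin.ofNat (operationCount + 1) (Operation.code o) = (Operation.code o).castSucc := by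
  ext; simp

theorem interp_answer {p : ℕ} (hp : w[p]? = some false) (b : Bool) :
    AnswersWithin interpTrans (interpConfig w
      (.readOperation (Operation.code (.inl b)).castSucc) p j C D) 1 b := by
  rw [AnswersWithin, Function.iterate_one, viewStep_interpConfig (s := .answer b) (adv := false)
    (m := .stay) (a := (C 0, .stay)) (d := D 0) (md := .stay)]
  simp only [interpTrans, onInterpTapes, toOption_wordTape_of_getElem? hp, Fin.val_castSucc,
    Fin.is_lt, dite_true, Fin.eta, Equiv.symm_apply_apply]
  rfl

theorem interp_act {p : ℕ} (hp : w[p]? = some false) (a : Option Bool) (m : HeadMove)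
    (adv : Bool) :
    viewStep interpTrans (interpConfig w
      (.readOperation (Operation.code (.inr (a, m, adv))).castSucc) p j C D) =
        interpConfig w .rewind p (if adv then j + 1 else j) C (act D a m) := by
  rw [viewStep_interpConfig (s := .work .rewind) (adv := adv) (m := .stay)
    (a := (C 0, .stay)) (d := a) (md := m), act_stay_self, HeadMove.toInt, add_zero]
  · rfl
  · simp only [interpTrans, onInterpTapes, toOption_wordTape_of_getElem? hp, Fin.val_castSucc,
      Fin.is_lt, dite_true, Fin.eta, Equiv.symm_apply_apply]

end Steps

section Cycle

variable {w v rest : List Bool} {j p m : ℕ} {D : ℤ → Option Bool} {r : ℕ × Operation}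

theorem interp_skipTable (rs : List (ℕ × Operation)) {e : Fin 10}
    (hrs : rs.length = e + m) (hw : w.drop p = encodeTable rs ++ rest) :
    (viewStep interpTrans)^[(encodeTable rs).length + rs.length]
      (interpConfig w (.skip e) p j (addressTape m : ℤ → TapeSym A) D) =
      interpConfig w (.skip 0) (p + (encodeTable rs).length : ℕ) j (addressTape 0) D := by
  induction rs generalizing e m p with
  | nil =>
    rw [List.length_nil] at hrs
    obtain rfl : e = 0 := Fin.ext (by rw [Fin.val_zero]; omega)
    obtain rfl : m = 0 := by omega
    rfl
  | cons r rs ih =>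
    rw [encodeTable, List.flatMap_cons, List.append_assoc] at hw
    rw [List.length_cons] at hrs
    have hsteps : (encodeTable (r :: rs)).length + (r :: rs).length =
        ((encodeTable rs).length + rs.length) + ((encodeEntry r).length + 1) := by
      simp only [encodeTable, List.flatMap_cons, List.length_append, List.length_cons]; ring
    have hend : p + (encodeTable (r :: rs)).length =
        p + (encodeEntry r).length + (encodeTable rs).length := by
      simp only [encodeTable, List.flatMap_cons, List.length_append]; ring
    rw [hsteps, hend, Function.iterate_add_apply, Function.iterate_succ_apply]
    by_cases he : e = 0
    · subst he
      obtain ⟨m, rfl⟩ : ∃ m', m = m' + 1 := ⟨m - 1, by rw [Fin.val_zero] at hrs; omega⟩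
      rw [interp_skip_pop, interp_skipEntry 0 hw]
      exact ih (by rw [Fin.val_zero] at hrs ⊢; omega) (drop_add_of_drop_eq_append hw)
    · rw [interp_skip_succ he, interp_skipEntry _ hw]
      have hpred : ∀ e : Fin 10, e ≠ 0 → (e - 1).val + 1 = e.val := by decide
      exact ih (by have := hpred e he; omega) (drop_add_of_drop_eq_append hw)

theorem length_le_length_encodeTable (tab : List (ℕ × Operation)) :
    tab.length ≤ (encodeTable tab).length := by
  induction tab with
  | nil => simp
  | cons r rs ih =>
    rw [encodeTable, List.flatMap_cons, List.length_append, length_encodeEntry, List.length_cons]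
    rw [encodeTable] at ih
    omega

theorem exists_encodeTable_eq_append {tab : List (ℕ × Operation)} {i : ℕ}
    (hr : tab[i]? = some r) : ∃ pre post, pre.length = i ∧
      encodeTable tab = encodeTable pre ++ (encodeEntry r ++ encodeTable post) := by
  obtain ⟨hi, rfl⟩ := List.getElem?_eq_some_iff.1 hr
  refine ⟨tab.take i, tab.drop (i + 1), List.length_take_of_le hi.le, ?_⟩
  calc encodeTable tab = encodeTable (tab.take i ++ tab[i] :: tab.drop (i + 1)) := by
        rw [← List.drop_eq_getElem_cons hi, List.take_append_drop]
    _ = _ := by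
        rw [encodeTable, List.flatMap_append, List.flatMap_cons]
        rfl

theorem interp_select {pre : List (ℕ × Operation)} (hw : w = encodeTable pre ++ rest)
    (hpre : pre.length = m + symbolIndex (w[j]?, D 0)) (hp : p < w.length) :
    (viewStep interpTrans)^[1 + (((encodeTable pre).length + pre.length) + (1 + (p + 1)))]
        (interpConfig w .rewind p j (addressTape m : ℤ → TapeSym A) D) =
      interpConfig w .readAddress (encodeTable pre).length j (loadingTape 0) D := by
  have hrewind := interp_rewind (j := j) (C := (addressTape m : ℤ → TapeSym A)) (D := D)
    (Nat.succ_le_of_lt hp)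
  rw [Nat.cast_succ, add_sub_cancel_right] at hrewind
  have hskip := interp_skipTable (A := A) (w := w) (p := 0) (j := j) (D := D) (m := m) pre
    (e := (symbolIndex (w[j]?, D 0)).castSucc)
    (by rw [hpre, Fin.val_castSucc, add_comm]) (by rw [List.drop_zero]; exact hw)
  rw [zero_add, Nat.cast_zero] at hskip
  exact iterate_trans (iterate_trans (iterate_trans hrewind interp_rewind_end) hskip)
    (interp_skip_zero _)

theorem interp_decode (hw : w.drop p = encodeEntry r ++ rest) :
    (viewStep interpTrans)^[Operation.code r.2 + (r.1 + 1)]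
        (interpConfig w .readAddress p j (loadingTape 0 : ℤ → TapeSym A) D) =
      interpConfig w (.readOperation (Operation.code r.2).castSucc)
        (p + r.1 + 1 + Operation.code r.2 : ℕ) j (addressTape r.1) D ∧
    w[p + r.1 + 1 + Operation.code r.2]? = some false := by
  rw [encodeEntry_append] at hw
  have hop := drop_succ_of_drop_eq_cons (drop_add_of_drop_eq_unary hw)
  refine ⟨?_, getElem?_of_drop_eq_cons (drop_add_of_drop_eq_unary hop)⟩
  have haddr := interp_readAddress (A := A) (j := j) (D := D) (m := 0) hw
  rw [zero_add] at haddr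
  rw [← ofNat_code]
  exact iterate_trans haddr (interp_readOperation hop)

theorem interp_fetch {tab : List (ℕ × Operation)} (hw : w = encodeTable tab ++ v)
    (hr : tab[m + symbolIndex (w[j]?, D 0)]? = some r) (hp : p < (encodeTable tab).length) :
    ∃ t < 4 * (encodeTable tab).length + 4, ∃ p' < (encodeTable tab).length,
      (viewStep interpTrans)^[t]
          (interpConfig w .rewind p j (addressTape m : ℤ → TapeSym A) D) =
        interpConfig w (.readOperation (Operation.code r.2).castSucc) p' j (addressTape r.1) D ∧
      w[p']? = some false := by
  obtain ⟨pre, post, hpre, htab⟩ := exists_encodeTable_eq_append hr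
  have hwpre : w = encodeTable pre ++ (encodeEntry r ++ (encodeTable post ++ v)) := by
    rw [hw, htab, List.append_assoc, List.append_assoc]
  have hselect := interp_select (A := A) hwpre hpre
    (p := p) (by rw [hw, List.length_append]; omega)
  obtain ⟨hdecode, hfalse⟩ := interp_decode (A := A) (j := j) (D := D)
    (show w.drop (encodeTable pre).length = encodeEntry r ++ (encodeTable post ++ v) by
      conv_lhs => rw [hwpre]
      exact List.drop_left)
  have hlen := congrArg List.length htab
  rw [List.length_append, List.length_append, length_encodeEntry] at hlen
  have := length_le_length_encodeTable pre
  exact ⟨_, by omega, _, by omega, iterate_trans hselect hdecode, hfalse⟩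

end Cycle

end Interpreter

/-! ### Programs for machines with one data tape -/

/-- Transition function of a machine that reads its input in one direction and has one data tape:
an answer, or the next state, the symbol written, the move, and whether the input advances. -/
abbrev DataTrans (σ : Type) : Type :=
  σ → Option Bool → Option Bool → Bool ⊕ (σ × Option Bool × HeadMove × Bool)

/-- Answer or state, position on the input, data tape seen from its head. -/
abbrev DataConfig (σ : Type) : Type := (Bool ⊕ σ) × ℕ × (ℤ → Option Bool)

section DataMachine

variable {σ : Type}

/-- One step on the input `w`. -/
def dataStep (w : List Bool) (δ : DataTrans σ) (c : DataConfig σ) : DataConfig σ :=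
  match c.1 with
  | .inl _ => c
  | .inr q =>
    match δ q w[c.2.1]? (c.2.2 0) with
    | .inl b => (.inl b, c.2)
    | .inr (q', a, m, adv) => (.inr q', if adv then c.2.1 + 1 else c.2.1, act c.2.2 a m)

/-- The initial configuration with state `q₀`. -/
def dataStart (q₀ : σ) : DataConfig σ := (.inr q₀, 0, fun _ => none)

section Step

variable {w : List Bool} {δ : DataTrans σ} {q q' : σ} {j : ℕ} {D : ℤ → Option Bool}

theorem dataStep_inr {a : Option Bool} {m : HeadMove} {adv : Bool}
    (h : δ q w[j]? (D 0) = .inr (q', a, m, adv)) :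
    dataStep w δ (.inr q, j, D) = (.inr q', if adv then j + 1 else j, act D a m) := by
  simp [dataStep, h]

theorem dataStep_iterate_succ_of_inl {b : Bool} (h : δ q w[j]? (D 0) = .inl b) (t : ℕ) :
    (dataStep w δ)^[t + 1] (.inr q, j, D) = (.inl b, j, D) := by
  rw [Function.iterate_succ_apply, show dataStep w δ (.inr q, j, D) = (.inl b, j, D) by
    simp [dataStep, h]]
  exact Function.iterate_fixed rfl t

end Step

variable {n : ℕ} (e : σ ≃ Fin (n + 1)) (δ : DataTrans σ)

/-- The instruction with which the interpreter carries out a transition, where `e` numbers the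
states and each state has a block of `9` instructions. -/
def dataInstruction : Bool ⊕ (σ × Option Bool × HeadMove × Bool) → ℕ × Operation
  | .inl b => (0, .inl b)
  | .inr (q', x) => (9 * e q', .inr x)

/-- The program of a machine with one data tape. -/
noncomputable def dataTable : List (ℕ × Operation) :=
  List.ofFn fun i : Fin ((n + 1) * 9) =>
    let xd := symbolIndex.symm (finProdFinEquiv.symm i).2
    dataInstruction e (δ (e.symm (finProdFinEquiv.symm i).1) xd.1 xd.2)

theorem getElem?_dataTable (q : σ) (x d : Option Bool) :
    (dataTable e δ)[9 * (e q : ℕ) + symbolIndex (x, d)]? = some (dataInstruction e (δ q x d)) := by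
  have hindex : 9 * (e q : ℕ) + symbolIndex (x, d) = finProdFinEquiv (e q, symbolIndex (x, d)) := by
    rw [finProdFinEquiv_apply_val, add_comm]
  rw [hindex, dataTable, List.getElem?_ofFn, dif_pos (Fin.is_lt _), Fin.eta]
  simp only [Equiv.symm_apply_apply]

theorem length_encodeTable_dataTable_pos : 0 < (encodeTable (dataTable e δ)).length :=
  lt_of_lt_of_le (by simp [dataTable]) (length_le_length_encodeTable _)

variable {e δ}

theorem answersWithin_interp_of_dataTable {A : Type} {w v : List Bool} {t : ℕ} {b : Bool}
    (hw : w = encodeTable (dataTable e δ) ++ v) {q : σ} {j p : ℕ} {D : ℤ → Option Bool}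
    (hp : p < (encodeTable (dataTable e δ)).length)
    (h : ((dataStep w δ)^[t] (.inr q, j, D)).1 = .inl b) :
    AnswersWithin interpTrans
      (interpConfig w .rewind p j (addressTape (9 * e q) : ℤ → TapeSym A) D)
      ((4 * (encodeTable (dataTable e δ)).length + 4) * t) b := by
  induction t generalizing q j p D with
  | zero => simp at h
  | succ t ih =>
    obtain ⟨s, hs, p', hp', hfetch, hfalse⟩ :=
      interp_fetch (A := A) hw (getElem?_dataTable e δ q w[j]? (D 0)) hp
    rcases hδ : δ q w[j]? (D 0) with b' | ⟨q', a, m, adv⟩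
    · rw [dataStep_iterate_succ_of_inl hδ, Sum.inl.injEq] at h
      subst h
      rw [hδ, dataInstruction] at hfetch
      exact ((interp_answer hfalse b').of_iterate hfetch).mono (by rw [mul_add]; omega)
    · rw [Function.iterate_succ_apply, dataStep_inr hδ] at h
      rw [hδ, dataInstruction] at hfetch
      have hstep := iterate_trans (t := 1) hfetch (interp_act hfalse a m adv)
      exact ((ih hp' h).of_iterate hstep).mono (by rw [mul_add]; omega)

theorem exists_table [Finite σ] (δ : DataTrans σ) (q₀ : σ) :
    ∃ (tab : List (ℕ × Operation)) (Z : ℕ), ∀ (A : Type) (v : List Bool) (t : ℕ) (b : Bool),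
      ((dataStep (encodeTable tab ++ v) δ)^[t] (dataStart q₀)).1 = .inl b →
        AnswersWithin interpTrans (interpStart (encodeTable tab ++ v) :
          ViewConfig InterpState InterpTape A) (Z * t) b := by
  obtain ⟨n, e, he⟩ := exists_equiv_fin_map_zero q₀
  refine ⟨dataTable e δ, 4 * (encodeTable (dataTable e δ)).length + 4, fun A v t b h => ?_⟩
  have hrun := answersWithin_interp_of_dataTable (A := A) rfl
    (length_encodeTable_dataTable_pos e δ) h
  rwa [he] at hrun

end DataMachine

/-! ### Simulating several tapes by sweeps over one tape -/

/-- A block of bits, one for each track. -/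
abbrev Block (K : ℕ) : Type := Fin (K + 1) → Bool

section Blocks

variable {K : ℕ}

/-- The block written over `b` when the bits of the buffer `κ` replace those selected by `mk`. -/
def mixBlock (mk κ b : Block K) : Block K := fun m => if mk m then κ m else b m

/-- The buffer after this replacement. -/
def carryBlock (mk κ b : Block K) : Block K := fun m => if mk m then b m else κ m

/-- A sequence of blocks with the tracks selected by `mk` delayed by one block, and the buffer. -/
def delayBlocks (mk : Block K) : Block K → List (Block K) → List (Block K) × Block K
  | κ, [] => ([], κ)
  | κ, b :: l => (mixBlock mk κ b :: (delayBlocks mk (carryBlock mk κ b) l).1,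
      (delayBlocks mk (carryBlock mk κ b) l).2)

/-- The cells holding a block. -/
def blockCells (b : Block K) : List (Option Bool) := List.ofFn fun m => some (b m)

/-- The cells holding a sequence of blocks. -/
def blocksCells (l : List (Block K)) : List (Option Bool) := l.flatMap blockCells

/-- The same sequence read backwards. -/
def mirrorBlocks (l : List (Block K)) : List (Block K) := l.reverse.map fun b m => b m.rev

/-- The bit in block `p`, track `m`. -/
def blockBit (l : List (Block K)) (p : ℕ) (m : Fin (K + 1)) : Bool := l.getD p (fun _ => false) m

@[simp] theorem blockBit_cons_zero (b : Block K) (l : List (Block K)) (m : Fin (K + 1)) :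
    blockBit (b :: l) 0 m = b m := rfl

@[simp] theorem blockBit_cons_succ (b : Block K) (l : List (Block K)) (p : ℕ) (m : Fin (K + 1)) :
    blockBit (b :: l) (p + 1) m = blockBit l p m := rfl

theorem length_delayBlocks (mk κ : Block K) (l : List (Block K)) :
    (delayBlocks mk κ l).1.length = l.length := by
  induction l generalizing κ with
  | nil => rfl
  | cons b l ih => simp [delayBlocks, ih]

theorem length_mirrorBlocks (l : List (Block K)) : (mirrorBlocks l).length = l.length := by
  simp [mirrorBlocks]

theorem delayBlocks_append_singleton (mk κ : Block K) (l : List (Block K)) (b : Block K) :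
    delayBlocks mk κ (l ++ [b]) =
      ((delayBlocks mk κ l).1 ++ [mixBlock mk (delayBlocks mk κ l).2 b],
        carryBlock mk (delayBlocks mk κ l).2 b) := by
  induction l generalizing κ with
  | nil => rfl
  | cons b' l ih => simp [delayBlocks, ih]

theorem mirrorBlocks_cons (b : Block K) (l : List (Block K)) :
    mirrorBlocks (b :: l) = mirrorBlocks l ++ [fun m => b m.rev] := by
  simp [mirrorBlocks]

theorem mirrorBlocks_append_singleton (l : List (Block K)) (b : Block K) :
    mirrorBlocks (l ++ [b]) = (fun m => b m.rev) :: mirrorBlocks l := by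
  simp [mirrorBlocks]

theorem blockCells_reverse (b : Block K) :
    (blockCells b).reverse = blockCells fun m => b m.rev := by
  refine List.ext_getElem (by simp [blockCells]) fun i _ _ => ?_
  simp only [blockCells, List.getElem_reverse, List.getElem_ofFn, List.length_ofFn]
  congr 2
  ext
  simp only [Fin.val_rev]
  omega

theorem blocksCells_append_singleton (l : List (Block K)) (b : Block K) :
    blocksCells (l ++ [b]) = blocksCells l ++ blockCells b := by
  simp [blocksCells]

theorem blocksCells_reverse (l : List (Block K)) :
    (blocksCells l).reverse = blocksCells (mirrorBlocks l) := by
  induction l with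
  | nil => rfl
  | cons b l ih =>
    rw [mirrorBlocks_cons, blocksCells_append_singleton, ← ih, ← blockCells_reverse,
      ← List.reverse_append]
    rfl

theorem blockBit_delayBlocks (mk κ : Block K) (l : List (Block K)) (p : ℕ) (m : Fin (K + 1)) :
    blockBit (delayBlocks mk κ (l ++ [fun _ => false])).1 p m =
      if mk m then (if p = 0 then κ m else blockBit l (p - 1) m) else blockBit l p m := by
  induction l generalizing κ p with
  | nil => cases p <;> simp [delayBlocks, blockBit, mixBlock]
  | cons b l ih =>
    cases p with
    | zero => simp [delayBlocks, mixBlock]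
    | succ p =>
      rw [List.cons_append, delayBlocks, blockBit_cons_succ, ih]
      cases p <;> by_cases hm : mk m <;> simp [hm, carryBlock]

theorem delayBlocks_mirrorBlocks_snd (mk : Block K) (l : List (Block K)) (m : Fin (K + 1)) :
    (delayBlocks mk (fun _ => false) (mirrorBlocks l)).2 m.rev = (mk m.rev && blockBit l 0 m) := by
  induction l with
  | nil => simp [mirrorBlocks, delayBlocks, blockBit]
  | cons b l ih =>
    rw [mirrorBlocks_cons, delayBlocks_append_singleton]
    simp only [carryBlock, ih]
    by_cases hm : mk m.rev <;> simp [hm]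

theorem blockBit_mirrorBlocks_delayBlocks (mk : Block K) (l : List (Block K)) (p : ℕ)
    (m : Fin (K + 1)) :
    blockBit (mirrorBlocks (delayBlocks mk (fun _ => false) (mirrorBlocks l)).1) p m =
      if mk m.rev then blockBit l (p + 1) m else blockBit l p m := by
  induction l generalizing p with
  | nil => simp [mirrorBlocks, delayBlocks, blockBit]
  | cons b l ih =>
    rw [mirrorBlocks_cons, delayBlocks_append_singleton, mirrorBlocks_append_singleton]
    cases p with
    | zero =>
      rw [blockBit_cons_zero, mixBlock, delayBlocks_mirrorBlocks_snd, Fin.rev_rev]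
      by_cases hm : mk m.rev <;> simp [hm]
    | succ p => exact ih p

theorem sweepTape_true_replicate {Γ : Type} [Inhabited Γ] (P : List Γ) (n : ℕ) :
    sweepTape true P (List.replicate n default) = sweepTape true P [] := by
  induction n with
  | zero => rfl
  | succ n ih =>
    rw [List.replicate_succ']
    exact (splitTape_append_default P _).trans ih

end Blocks

instance (M : MultitapeTM) : Finite M.Q := M.finite_Q

instance (M : MultitapeTM) : Finite M.A := M.finite_A

instance {A : Type} [Finite A] : Finite (TapeSym A) :=
  Finite.of_surjective (fun x : Option (Bool ⊕ A) => match x with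
    | none => TapeSym.blank
    | some (.inl b) => .bit b
    | some (.inr a) => .aux a) (by
    rintro (_ | b | a)
    exacts [⟨none, rfl⟩, ⟨some (.inl b), rfl⟩, ⟨some (.inr a), rfl⟩])

/-- The symbol marked by a track in one-hot encoding. -/
noncomputable def decodeTrack {G : Type} (u : G → Bool) : Option G :=
  open Classical in if h : ∃ g, u g = true then some h.choose else none

theorem decodeTrack_eq {G : Type} {u : G → Bool} {o : Option G}
    (h : ∀ g, u g = true ↔ o = some g) : decodeTrack u = o := by
  rw [decodeTrack]
  split_ifs with hu
  · exact ((h _).1 hu.choose_spec).symm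
  · exact (Option.eq_none_iff_forall_ne_some.2 fun g hg => hu ⟨g, (h g).2 hg⟩).symm

/-- Whether a move pushes the symbol left behind onto the stack on the given side
(`true` is the right side). -/
def HeadMove.pushes : HeadMove → Bool → Bool
  | .left, true => true
  | .right, false => true
  | _, _ => false

/-- Whether a move pops the scanned symbol from the stack on the given side. -/
def HeadMove.pops (m : HeadMove) (side : Bool) : Bool := m.pushes !side

theorem HeadMove.pushes_eq_false_of_pops {m : HeadMove} {side : Bool} (h : m.pops side = true) :
    m.pushes side = false := by
  cases m <;> cases side <;> simp_all [pops, pushes]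

namespace MultitapeTM

/-- The symbols written and the moves made in a step. -/
abbrev Actions (M : MultitapeTM) : Type := Fin (M.k + 1) → TapeSym M.A × HeadMove

/-- The tracks: the two stacks of each tape, in one-hot encoding. -/
abbrev Track (M : MultitapeTM) : Type := Fin (M.k + 1) × Bool × TapeSym M.A

/-- States of the sweeping machine: sweeping with a buffer, at a given track, or turning back. -/
inductive SweepState (M : MultitapeTM) (K : ℕ) : Type
  | pass (d : Bool) (q : M.Q) (a : M.Actions) (κ : Block K) (m : Fin (K + 1))
  | turn (q : M.Q) (a : M.Actions)

instance (M : MultitapeTM) (K : ℕ) : Finite (M.SweepState K) :=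
  Finite.of_surjective
    (fun x : (Bool × M.Q × M.Actions × Block K × Fin (K + 1)) ⊕ (M.Q × M.Actions) => match x with
      | .inl (d, q, a, κ, m) => SweepState.pass d q a κ m
      | .inr (q, a) => .turn q a) (by
    rintro (⟨d, q, a, κ, m⟩ | ⟨q, a⟩)
    exacts [⟨.inl (d, q, a, κ, m), rfl⟩, ⟨.inr (q, a), rfl⟩])

section Sweep

variable (M : MultitapeTM) {K : ℕ} (e : M.Track ≃ Fin (K + 1))

/-- The tracks shifted during a sweep to the right (pushes) or to the left (pops). On the way left
the tracks of a block are met in reverse order. -/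
def sweepMask (d : Bool) (a : M.Actions) : Block K := fun m =>
  if d then (a (e.symm m).1).2.pushes (e.symm m).2.1
  else (a (e.symm m.rev).1).2.pops (e.symm m.rev).2.1

/-- The symbol popped into the buffer from a stack, if there is one. -/
noncomputable def poppedSym (κ : Block K) (i : Fin (M.k + 1)) (side : Bool) :
    Option (TapeSym M.A) :=
  decodeTrack fun g => κ (e (i, side, g)).rev

/-- The symbols scanned after the actions `a`, from the buffer of popped symbols and the next
input letter. -/
noncomputable def scannedSym (a : M.Actions) (κ : Block K) (x : Option Bool) (i : Fin (M.k + 1)) :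
    TapeSym M.A :=
  match (a i).2 with
  | .stay => (a i).1
  | .left => (M.poppedSym e κ i false).getD .blank
  | .right => (M.poppedSym e κ i true).getD (if i = 0 then .ofOption x else .blank)

/-- Whether tape `i` moves right with an empty stack on that side. For the input tape this consumes
an input letter. -/
noncomputable def popsEmpty (a : M.Actions) (κ : Block K) (i : Fin (M.k + 1)) : Bool :=
  match (a i).2 with
  | .right => (M.poppedSym e κ i true).isNone
  | _ => false

/-- The buffer of the symbols to be pushed. -/
noncomputable def pushBuffer (a : M.Actions) : Block K := fun m =>
  open Classical in decide ((a (e.symm m).1).1 = (e.symm m).2.2)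

/-- The sweeping machine simulating `M` and answering the opposite. At a cell of a selected track
it exchanges the bit in the cell with the bit in the buffer. -/
noncomputable def sweepTrans : DataTrans (M.SweepState K)
  | .turn q a, _, _ => .inr (.pass false q a (fun _ => false) 0, none, .left, false)
  | .pass d q a κ m, x, c =>
    if d = false ∧ c = none then
      match M.δ q (M.scannedSym e a κ x) with
      | (.work q', a') =>
          .inr (.pass true q' a' (M.pushBuffer e a') 0, none, .right, M.popsEmpty e a κ 0)
      | (.no, _) => .inl true
      | _ => .inl false
    else
      let b : Block K := fun _ => c.getD false
      .inr (if m = Fin.last K ∧ c = none then .turn q a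
          else .pass d q a (Function.update κ m (carryBlock (M.sweepMask e d a) κ b m)) (m + 1),
        some (mixBlock (M.sweepMask e d a) κ b m), sweepMove d, false)

/-- The initial state of the sweeping machine. The first symbol of the input is scanned after
moving right from the blank before it. -/
def sweepStart : M.SweepState K :=
  .pass false M.start (fun i => (.blank, if i = 0 then .right else .stay)) (fun _ => false) 0

variable {M} (w : List Bool) (j : ℕ) (q : M.Q) (a : M.Actions) (κ : Block K)

theorem sweep_cell {d : Bool} (m : Fin (K + 1)) (P R : List (Option Bool)) (c : Option Bool)
    (hc : d = true ∨ c ≠ none) :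
    dataStep w (M.sweepTrans e) (.inr (.pass d q a κ m), j, sweepTape d P (c :: R)) =
      (.inr (if m = Fin.last K ∧ c = none then .turn q a
          else .pass d q a (Function.update κ m
            (carryBlock (M.sweepMask e d a) κ (fun _ => c.getD false) m)) (m + 1)), j,
        sweepTape d (some (mixBlock (M.sweepMask e d a) κ (fun _ => c.getD false) m) :: P) R) := by
  have h : ¬ (d = false ∧ c = none) := by
    rintro ⟨rfl, rfl⟩
    simp at hc
  rw [dataStep_inr (by simp only [sweepTrans, sweepTape_zero, List.headD_cons, if_neg h]; rfl),
    act_sweepTape]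
  rfl

variable {κ}

theorem sweep_cells_lt {d : Bool} (P R : List (Option Bool)) (c : Fin (K + 1) → Option Bool)
    (hc : d = true ∨ ∀ i, c i ≠ none) {n : ℕ} (hn : n < K + 1) :
    (dataStep w (M.sweepTrans e))^[n]
      (.inr (.pass d q a κ 0), j, sweepTape d P (List.ofFn c ++ R)) =
      (.inr (.pass d q a (fun i => if i < ⟨n, hn⟩ then
          carryBlock (M.sweepMask e d a) κ (fun i => (c i).getD false) i else κ i) ⟨n, hn⟩), j,
        sweepTape d (((List.ofFn fun i => some (mixBlock (M.sweepMask e d a) κ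
          (fun i => (c i).getD false) i)).take n).reverse ++ P) ((List.ofFn c).drop n ++ R)) := by
  induction n with
  | zero => simp
  | succ n ih =>
    have hn' : n < K + 1 := by omega
    have hlast : (⟨n, hn'⟩ : Fin (K + 1)) ≠ Fin.last K := by
      simp only [ne_eq, Fin.ext_iff, Fin.val_last]
      omega
    have hsucc : (⟨n, hn'⟩ + 1 : Fin (K + 1)) = ⟨n + 1, hn⟩ :=
      Fin.ext (Fin.val_add_one_of_lt (lt_of_le_of_ne (Fin.le_last _) hlast))
    have hlt : ∀ i : Fin (K + 1), i < ⟨n + 1, hn⟩ ↔ i < ⟨n, hn'⟩ ∨ i = ⟨n, hn'⟩ := fun i => by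
      simp only [Fin.lt_def, Fin.ext_iff]
      omega
    rw [Function.iterate_succ_apply', ih hn', List.drop_eq_getElem_cons (by simpa using hn'),
      List.getElem_ofFn, List.cons_append, sweep_cell _ _ _ _ _ _ _ _ _ _ (hc.imp id fun h => h _),
      if_neg fun h => hlast h.1, hsucc]
    refine Prod.ext ?_ (Prod.ext rfl ?_)
    · refine congrArg (fun κ' => Sum.inr (SweepState.pass d q a κ' ⟨n + 1, hn⟩))
        (funext fun i => ?_)
      rcases eq_or_ne i ⟨n, hn'⟩ with rfl | hi
      · simp [hlt, carryBlock]
      · simp [hlt, hi]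
    · rw [List.take_succ_eq_append_getElem (by simpa using hn'), List.reverse_append,
        List.getElem_ofFn]
      simp [mixBlock, -List.ofFn_succ]

theorem sweep_cells {d : Bool} (P R : List (Option Bool)) (c : Fin (K + 1) → Option Bool)
    (hc : d = true ∨ ∀ i, c i ≠ none) :
    (dataStep w (M.sweepTrans e))^[K + 1]
      (.inr (.pass d q a κ 0), j, sweepTape d P (List.ofFn c ++ R)) =
      (.inr (if c (Fin.last K) = none then .turn q a
          else .pass d q a (carryBlock (M.sweepMask e d a) κ fun i => (c i).getD false) 0), j,
        sweepTape d ((blockCells (mixBlock (M.sweepMask e d a) κ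
          fun i => (c i).getD false)).reverse ++ P) R) := by
  have hK : K < K + 1 := by omega
  have hlast : (⟨K, hK⟩ : Fin (K + 1)) = Fin.last K := rfl
  rw [Function.iterate_succ_apply', sweep_cells_lt _ _ _ _ _ _ _ _ hc hK,
    List.drop_eq_getElem_cons (by simp), List.getElem_ofFn, List.cons_append,
    sweep_cell _ _ _ _ _ _ _ _ _ _ (hc.imp id fun h => h _), hlast, Fin.last_add_one]
  refine Prod.ext ?_ (Prod.ext rfl ?_)
  · simp only [true_and]
    congr 3
    funext i
    rcases eq_or_ne i (Fin.last K) with rfl | hi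
    · simp [carryBlock]
    · simp [hi, Fin.lt_last_iff_ne_last]
  · have hcells : ∀ f : Fin (K + 1) → Option Bool,
        List.ofFn f = (List.ofFn f).take K ++ [f (Fin.last K)] := fun f => by
      rw [List.ofFn_succ_last, List.take_left' (by simp)]
    rw [blockCells, hcells fun i => some _, List.drop_of_length_le (by simp)]
    simp [mixBlock, -List.ofFn_succ]

theorem sweep_block {d : Bool} (b : Block K) (P R : List (Option Bool)) :
    (dataStep w (M.sweepTrans e))^[K + 1]
      (.inr (.pass d q a κ 0), j, sweepTape d P (blockCells b ++ R)) =
      (.inr (.pass d q a (carryBlock (M.sweepMask e d a) κ b) 0), j,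
        sweepTape d ((blockCells (mixBlock (M.sweepMask e d a) κ b)).reverse ++ P) R) :=
  sweep_cells e w j q a P R (fun i => some (b i)) (by simp)

theorem sweep_extend (P : List (Option Bool)) :
    (dataStep w (M.sweepTrans e))^[K + 1]
      (.inr (.pass true q a κ 0), j, sweepTape true P []) =
      (.inr (.turn q a), j, sweepTape true
        ((blockCells (mixBlock (M.sweepMask e true a) κ fun _ => false)).reverse ++ P) []) := by
  have h := sweep_cells (κ := κ) e w j q a P [] (fun _ => none) (.inl rfl)
  rw [List.append_nil, List.ofFn_const] at h
  rw [← sweepTape_true_replicate P (K + 1)]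
  exact h

theorem sweep_blocks {d : Bool} (l : List (Block K)) (P R : List (Option Bool)) :
    (dataStep w (M.sweepTrans e))^[l.length * (K + 1)]
      (.inr (.pass d q a κ 0), j, sweepTape d P (blocksCells l ++ R)) =
      (.inr (.pass d q a (delayBlocks (M.sweepMask e d a) κ l).2 0), j,
        sweepTape d ((blocksCells (delayBlocks (M.sweepMask e d a) κ l).1).reverse ++ P) R) := by
  induction l generalizing κ P with
  | nil => simp [delayBlocks, blocksCells]
  | cons b l ih =>
    rw [List.length_cons, add_one_mul, blocksCells, List.flatMap_cons, List.append_assoc]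
    refine (iterate_trans (sweep_block e w j q a b P (blocksCells l ++ R)) (ih _)).trans ?_
    simp [delayBlocks, blocksCells]

end Sweep

end MultitapeTM

namespace MultitapeTM

section Simulation

variable (M : MultitapeTM) {K : ℕ} (e : M.Track ≃ Fin (K + 1)) (w : List Bool)

/-- The contents of the two stacks of each tape, from the top. -/
abbrev Stacks : Type := Fin (M.k + 1) → Bool → List (TapeSym M.A)

/-- The stacks `st` are stored in the blocks `l`. -/
def StoresStacks (l : List (Block K)) (st : M.Stacks) : Prop :=
  ∀ i side p g, blockBit l p (e (i, side, g)) = true ↔ (st i side)[p]? = some g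

/-- The unread part of the input, on the tape `i`. -/
def unreadInput (j : ℕ) (i : Fin (M.k + 1)) : List (TapeSym M.A) :=
  if i = 0 then (w.drop j).map .bit else []

/-- The sweeping machine is about to leave its home position, having stored the configuration `c`
of `M` in `n` blocks and a buffer. -/
def AtHome (c : ViewConfig M.Q (Fin (M.k + 1)) M.A) (X : DataConfig (M.SweepState K)) (n : ℕ) :
    Prop :=
  ∃ (q : M.Q) (a : M.Actions) (κ : Block K) (l : List (Block K)) (j : ℕ) (st : M.Stacks),
    X = (.inr (.pass false q a κ 0), j, sweepTape false (blocksCells l) []) ∧ l.length = n ∧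
    c.1 = .work q ∧ M.StoresStacks e l st ∧
    ∀ i, c.2 i = splitTape (st i false) (M.scannedSym e a κ w[j]? i ::
      (st i true ++ M.unreadInput w (if M.popsEmpty e a κ 0 then j + 1 else j) i))

variable {M} {w}

/-- The stacks after a step. -/
def stepStacks (a : M.Actions) (st : M.Stacks) : M.Stacks := fun i side =>
  if (a i).2.pushes side then (a i).1 :: st i side
  else if (a i).2.pops side then (st i side).tail else st i side

/-- The blocks after the sweep to the right. -/
noncomputable def pushedBlocks (a : M.Actions) (l : List (Block K)) : List (Block K) :=
  (delayBlocks (M.sweepMask e true a) (M.pushBuffer e a) (l ++ [fun _ => false])).1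

/-- The blocks and the buffer after the sweep back, which reads the blocks backwards. -/
noncomputable def poppedBlocks (a : M.Actions) (l : List (Block K)) : List (Block K) × Block K :=
  delayBlocks (M.sweepMask e false a) (fun _ => false) (mirrorBlocks (pushedBlocks e a l))

theorem length_pushedBlocks (a : M.Actions) (l : List (Block K)) :
    (pushedBlocks e a l).length = l.length + 1 := by
  simp [pushedBlocks, length_delayBlocks]

section Stacks

variable {e} {l : List (Block K)} {st : M.Stacks}

theorem blockBit_pushedBlocks (h : M.StoresStacks e l st) (a : M.Actions) (i : Fin (M.k + 1))
    (side : Bool) (p : ℕ) (g : TapeSym M.A) :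
    blockBit (pushedBlocks e a l) p (e (i, side, g)) = true ↔
      (if (a i).2.pushes side then (a i).1 :: st i side else st i side)[p]? = some g := by
  have hmask : M.sweepMask e true a (e (i, side, g)) = (a i).2.pushes side := by simp [sweepMask]
  rw [pushedBlocks, blockBit_delayBlocks, hmask]
  by_cases hp : (a i).2.pushes side
  · rw [if_pos hp, if_pos hp]
    cases p with
    | zero => simp [pushBuffer]
    | succ p => simpa using h i side p g
  · rw [if_neg hp, if_neg hp]
    exact h i side p g

theorem sweepMask_false_rev (a : M.Actions) (i : Fin (M.k + 1)) (side : Bool)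
    (g : TapeSym M.A) :
    M.sweepMask e false a (e (i, side, g)).rev = (a i).2.pops side := by simp [sweepMask]

theorem storesStacks_poppedBlocks (h : M.StoresStacks e l st) (a : M.Actions) :
    M.StoresStacks e (mirrorBlocks (poppedBlocks e a l).1) (stepStacks a st) := by
  intro i side p g
  rw [poppedBlocks, blockBit_mirrorBlocks_delayBlocks, sweepMask_false_rev]
  by_cases hp : (a i).2.pops side
  · rw [if_pos hp, blockBit_pushedBlocks h]
    simp [stepStacks, HeadMove.pushes_eq_false_of_pops hp, hp]
  · rw [if_neg hp, blockBit_pushedBlocks h]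
    simp [stepStacks, hp]

theorem poppedSym_poppedBlocks (h : M.StoresStacks e l st) (a : M.Actions) {i : Fin (M.k + 1)}
    {side : Bool} (hp : (a i).2.pops side = true) :
    M.poppedSym e (poppedBlocks e a l).2 i side = (st i side).head? := by
  refine decodeTrack_eq fun g => ?_
  rw [poppedBlocks, delayBlocks_mirrorBlocks_snd, sweepMask_false_rev, hp, Bool.true_and,
    blockBit_pushedBlocks h, HeadMove.pushes_eq_false_of_pops hp, List.head?_eq_getElem?]
  rfl

end Stacks

theorem unreadInput_congr {j j' : ℕ} {i : Fin (M.k + 1)} (h : i = 0 → j = j') :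
    M.unreadInput w j i = M.unreadInput w j' i := by
  rw [unreadInput, unreadInput]
  split_ifs with hi
  · rw [h hi]
  · rfl

theorem splitTape_unreadInput (L : List (TapeSym M.A)) (j : ℕ) (i : Fin (M.k + 1)) :
    splitTape L (M.unreadInput w j i) = splitTape L
      ((if i = 0 then .ofOption w[j]? else .blank) :: M.unreadInput w (j + 1) i) := by
  rw [unreadInput, unreadInput]
  split_ifs with hi
  · by_cases hj : j < w.length
    · rw [List.drop_eq_getElem_cons hj, List.map_cons, List.getElem?_eq_getElem hj]
      rfl
    · rw [List.drop_of_length_le (by omega), List.drop_of_length_le (by omega),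
        List.getElem?_eq_none (by omega)]
      exact (splitTape_right_default L).symm
  · exact (splitTape_right_default L).symm

theorem act_eq_splitTape {l : List (Block K)} {st : M.Stacks} (h : M.StoresStacks e l st)
    (a : M.Actions) (s : TapeSym M.A) (j : ℕ) (i : Fin (M.k + 1)) :
    act (splitTape (st i false) (s :: (st i true ++ M.unreadInput w j i))) (a i).1 (a i).2 =
      splitTape (stepStacks a st i false) (M.scannedSym e a (poppedBlocks e a l).2 w[j]? i ::
        (stepStacks a st i true ++ M.unreadInput w
          (if M.popsEmpty e a (poppedBlocks e a l).2 0 then j + 1 else j) i)) := by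
  rw [unreadInput_congr (j := if M.popsEmpty e a (poppedBlocks e a l).2 0 then j + 1 else j)
    (j' := if M.popsEmpty e a (poppedBlocks e a l).2 i then j + 1 else j) (by rintro rfl; rfl)]
  rcases hm : (a i).2 with _ | _ | _
  · have hpop := poppedSym_poppedBlocks h a (i := i) (side := false) (by rw [hm]; rfl)
    simp [act_splitTape_left, scannedSym, popsEmpty, hm, hpop, stepStacks, HeadMove.pushes,
      HeadMove.pops, List.headD_eq_head?_getD, TapeSym.default_eq]
  · simp [act_splitTape_stay, scannedSym, popsEmpty, hm, stepStacks, HeadMove.pushes,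
      HeadMove.pops]
  · have hpop := poppedSym_poppedBlocks h a (i := i) (side := true) (by rw [hm]; rfl)
    rw [act_splitTape_right, List.tail_cons]
    simp only [scannedSym, popsEmpty, hm, hpop, stepStacks, HeadMove.pushes, HeadMove.pops]
    rcases st i true with _ | ⟨g, st'⟩
    · simpa using splitTape_unreadInput ((a i).1 :: st i false) j i
    · simp

section Round

variable {q q' : M.Q} {a a' : M.Actions} {κ : Block K} {j : ℕ}

theorem dataStep_sweepTrans_answer {b : Bool} {P : List (Option Bool)}
    (h : (M.δ q (M.scannedSym e a κ w[j]?)).1 = .answer b) :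
    (dataStep w (M.sweepTrans e)
      (.inr (.pass false q a κ 0), j, sweepTape false P [])).1 = .inl !b := by
  rcases hδ : M.δ q (M.scannedSym e a κ w[j]?) with ⟨r, a'⟩
  rw [hδ] at h
  subst h
  cases b <;> simp [dataStep, sweepTrans, hδ, Option.default_eq_none, Ctrl.answer]

theorem dataStep_sweepTrans_work {P : List (Option Bool)}
    (h : M.δ q (M.scannedSym e a κ w[j]?) = (.work q', a')) :
    dataStep w (M.sweepTrans e) (.inr (.pass false q a κ 0), j, sweepTape false P []) =
      (.inr (.pass true q' a' (M.pushBuffer e a') 0), if M.popsEmpty e a κ 0 then j + 1 else j,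
        sweepTape true [] P) := by
  rw [dataStep_inr (q' := .pass true q' a' (M.pushBuffer e a') 0) (a := none) (m := .right)
    (adv := M.popsEmpty e a κ 0) (by simp [sweepTrans, h, Option.default_eq_none])]
  exact Prod.ext rfl (Prod.ext rfl (act_sweepTape_turn false P))

variable (w q a j) in
theorem dataStep_sweepTrans_turn (P : List (Option Bool)) :
    dataStep w (M.sweepTrans e) (.inr (.turn q a), j, sweepTape true P []) =
      (.inr (.pass false q a (fun _ => false) 0), j, sweepTape false [] P) := by
  rw [dataStep_inr (q' := .pass false q a (fun _ => false) 0) (a := none) (m := .left)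
    (adv := false) (by simp [sweepTrans])]
  exact Prod.ext rfl (Prod.ext rfl (act_sweepTape_turn true P))

variable (w q a j) in
theorem sweep_push (l : List (Block K)) :
    (dataStep w (M.sweepTrans e))^[(l.length + 1) * (K + 1)]
      (.inr (.pass true q a (M.pushBuffer e a) 0), j, sweepTape true [] (blocksCells l)) =
      (.inr (.turn q a), j,
        sweepTape true (blocksCells (mirrorBlocks (pushedBlocks e a l))) []) := by
  have hl := sweep_blocks e w j q a (κ := M.pushBuffer e a) (d := true) l [] []
  rw [List.append_nil] at hl
  rw [add_one_mul, add_comm, iterate_trans hl (sweep_extend e w j q a _), List.append_nil,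
    ← List.reverse_append, ← blocksCells_append_singleton, blocksCells_reverse, pushedBlocks,
    delayBlocks_append_singleton]

variable (w q a j) in
theorem sweep_pop (l : List (Block K)) :
    (dataStep w (M.sweepTrans e))^[(l.length + 1) * (K + 1)]
      (.inr (.pass false q a (fun _ => false) 0), j,
        sweepTape false [] (blocksCells (mirrorBlocks (pushedBlocks e a l)))) =
      (.inr (.pass false q a (poppedBlocks e a l).2 0), j,
        sweepTape false (blocksCells (mirrorBlocks (poppedBlocks e a l).1)) []) := by
  have hl := sweep_blocks e w j q a (κ := fun _ => false) (d := false)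
    (mirrorBlocks (pushedBlocks e a l)) [] []
  rw [length_mirrorBlocks, length_pushedBlocks] at hl
  rw [← List.append_nil (blocksCells (mirrorBlocks (pushedBlocks e a l))), hl,
    blocksCells_reverse, List.append_nil]
  rfl

end Round

section AtHome

variable {e} {c : ViewConfig M.Q (Fin (M.k + 1)) M.A} {X : DataConfig (M.SweepState K)} {n : ℕ}

theorem atHome_start : M.AtHome e w (M.init w).view (dataStart M.sweepStart) 0 := by
  have hpop : ∀ (i : Fin (M.k + 1)) side, M.poppedSym e (fun _ => false) i side = none :=
    fun i side => decodeTrack_eq fun g => by simp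
  refine ⟨M.start, fun i => (.blank, if i = 0 then .right else .stay), fun _ => false, [], 0,
    fun _ _ => [], ?_, rfl, rfl, ?_, fun i => ?_⟩
  · refine Prod.ext rfl (Prod.ext rfl (funext fun z => ?_))
    rcases z with (_ | n) | n <;> rfl
  · intro i side p g
    simp [blockBit]
  · rw [view_init]
    by_cases hi : i = 0
    · subst hi
      have h := splitTape_unreadInput (M := M) (w := w) [] 0 0
      simp only [unreadInput, if_true, List.drop_zero] at h
      simp only [if_true]
      rw [wordTape_eq_splitTape, h]
      simp [scannedSym, popsEmpty, hpop, unreadInput]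
    · simp only [hi, if_false, scannedSym, unreadInput]
      rw [wordTape_eq_splitTape]
      exact (splitTape_right_default []).symm

theorem AtHome.answer (h : M.AtHome e w c X n) {b : Bool} (hb : (viewStep M.δ c).1 = .answer b) :
    (dataStep w (M.sweepTrans e) X).1 = .inl !b := by
  obtain ⟨q, a, κ, l, j, st, rfl, -, hq, -, htape⟩ := h
  obtain ⟨r, T⟩ := c
  obtain rfl : r = .work q := hq
  rw [viewStep_work, show (fun i => T i 0) = M.scannedSym e a κ w[j]? from
    funext fun i => (congrFun (htape i) 0).trans (splitTape_zero _ _)] at hb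
  exact dataStep_sweepTrans_answer e hb

theorem AtHome.step (h : M.AtHome e w c X n) (hw : (viewStep M.δ c).1.IsWork) :
    M.AtHome e w (viewStep M.δ c)
      ((dataStep w (M.sweepTrans e))^[2 * (n + 1) * (K + 1) + 2] X) (n + 1) := by
  obtain ⟨q, a, κ, l, j, st, rfl, rfl, hq, hst, htape⟩ := h
  obtain ⟨r, T⟩ := c
  obtain rfl : r = .work q := hq
  have hscan : (fun i => T i 0) = M.scannedSym e a κ w[j]? :=
    funext fun i => (congrFun (htape i) 0).trans (splitTape_zero _ _)
  rcases hδ : M.δ q (M.scannedSym e a κ w[j]?) with ⟨r, a'⟩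
  rw [viewStep_work, hscan, hδ] at hw ⊢
  obtain ⟨q', rfl⟩ : ∃ q', r = .work q' := hw
  set j' := if M.popsEmpty e a κ 0 then j + 1 else j
  rw [show 2 * (l.length + 1) * (K + 1) + 2 =
      (l.length + 1) * (K + 1) + ((l.length + 1) * (K + 1) + 1) + 1 by ring,
    Function.iterate_succ_apply, dataStep_sweepTrans_work e hδ, Function.iterate_add_apply,
    Function.iterate_succ_apply', sweep_push, dataStep_sweepTrans_turn, sweep_pop]
  refine ⟨q', a', (poppedBlocks e a' l).2, mirrorBlocks (poppedBlocks e a' l).1, j',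
    stepStacks a' st, rfl, ?_, rfl, storesStacks_poppedBlocks hst a', fun i => ?_⟩
  · rw [length_mirrorBlocks, poppedBlocks, length_delayBlocks, length_mirrorBlocks,
      length_pushedBlocks]
  · exact (congrArg (act · (a' i).1 (a' i).2) (htape i)).trans (act_eq_splitTape e hst a' _ _ _)

theorem exists_atHome_iterate (t : ℕ) (h : ((viewStep M.δ)^[t] (M.init w).view).1.IsWork) :
    ∃ s ≤ (2 * K + 4) * t ^ 2, M.AtHome e w ((viewStep M.δ)^[t] (M.init w).view)
      ((dataStep w (M.sweepTrans e))^[s] (dataStart M.sweepStart)) t := by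
  induction t with
  | zero => exact ⟨0, by simp, atHome_start⟩
  | succ t ih =>
    obtain ⟨s, hs, hhome⟩ := ih (isWork_of_le h (Nat.le_succ t))
    rw [Function.iterate_succ_apply'] at h ⊢
    refine ⟨2 * (t + 1) * (K + 1) + 2 + s, by nlinarith, ?_⟩
    rw [Function.iterate_add_apply]
    exact hhome.step h

theorem exists_sweep_answer {t : ℕ} {b : Bool} (h : M.AnswersWithin w t b) :
    ∃ s ≤ (2 * K + 5) * (t + 1) ^ 2,
      ((dataStep w (M.sweepTrans e))^[s] (dataStart M.sweepStart)).1 = .inl !b := by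
  rw [answersWithin_iff] at h
  obtain ⟨s, hst, hwork, hhalt⟩ := _root_.exists_lastStepAt ⟨M.start, rfl⟩ h.not_isWork
  obtain ⟨r, hr, hhome⟩ := exists_atHome_iterate (e := e) s hwork
  rw [_root_.AnswersWithin, viewStep_iterate_eq_of_le hhalt hst, Function.iterate_succ_apply'] at h
  refine ⟨r + 1, ?_, ?_⟩
  · have hsq : s ^ 2 ≤ (t + 1) ^ 2 := Nat.pow_le_pow_left (by omega) 2
    nlinarith [Nat.one_le_pow 2 (t + 1) (by omega)]
  · rw [Function.iterate_succ_apply']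
    exact hhome.answer h

end AtHome

end Simulation

theorem exists_program (M : MultitapeTM) :
    ∃ (u : List Bool) (Z : ℕ), ∀ (A : Type) (v : List Bool) (t : ℕ) (b : Bool),
      M.AnswersWithin (u ++ v) t b →
        _root_.AnswersWithin interpTrans
          (interpStart (u ++ v) : ViewConfig InterpState InterpTape A) (Z * (t + 1) ^ 2) !b := by
  obtain ⟨K, e, -⟩ := exists_equiv_fin_map_zero ((0, true, .blank) : M.Track)
  obtain ⟨tab, Z, hZ⟩ := exists_table (M.sweepTrans e) M.sweepStart
  refine ⟨encodeTable tab, Z * (2 * K + 5), fun A v t b h => ?_⟩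
  obtain ⟨s, hs, hans⟩ := exists_sweep_answer (e := e) h
  rw [mul_assoc]
  exact (hZ A v s _ hans).mono (Nat.mul_le_mul_left Z hs)

end MultitapeTM

/-! ### The clock -/

namespace MultitapeTM

theorem wordTape_injective {A : Type} :
    Function.Injective (wordTape : List Bool → ℤ → TapeSym A) := fun u v h =>
  List.ext_getElem? fun j => by rw [← toOption_wordTape u j, h, toOption_wordTape]

variable (M : MultitapeTM)

theorem step_of_not_isWork (c : M.Config) (h : ¬ c.state.IsWork) : M.step c = c := by
  rcases c with ⟨_ | _ | _ | _, T, p⟩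
  · exact absurd ⟨_, rfl⟩ h
  all_goals rfl

theorem step_head_le (c : M.Config) (i : Fin (M.k + 1)) : (M.step c).head i ≤ c.head i + 1 := by
  rcases c with ⟨q | _ | _ | _, T, p⟩
  · refine add_le_add_right (?_ : HeadMove.toInt _ ≤ 1) (p i)
    rcases ((M.δ q fun i => T i (p i)).2 i).2 <;> decide
  all_goals exact (lt_add_one (p i)).le

theorem step_tape_of_ne_head {c : M.Config} {i : Fin (M.k + 1)} {z : ℤ} (hz : z ≠ c.head i) :
    (M.step c).tape i z = c.tape i z := by
  rcases c with ⟨q | _ | _ | _, T, p⟩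
  · exact Function.update_of_ne hz _ _
  all_goals rfl

theorem run_succ (w : List Bool) (t : ℕ) : M.run w (t + 1) = M.step (M.run w t) :=
  Function.iterate_succ_apply' _ _ _

variable {M} {w : List Bool}

theorem run_eq_of_le {s t : ℕ} (h : ¬ (M.run w s).state.IsWork) (hst : s ≤ t) :
    M.run w t = M.run w s :=
  iterate_eq_of_not (P := fun c : M.Config => c.state.IsWork) M.step_of_not_isWork h hst

variable (M w)

theorem run_head_le (t : ℕ) (i : Fin (M.k + 1)) : (M.run w t).head i ≤ t := by
  induction t with
  | zero => exact le_rfl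
  | succ t ih =>
    rw [run_succ]
    exact (M.step_head_le _ i).trans (by push_cast; gcongr)

variable {M w}

theorem run_tape_eq_blank_of_le {i : Fin (M.k + 1)} (hi : i ≠ 0) {t : ℕ} {z : ℤ}
    (hz : (t : ℤ) ≤ z) : (M.run w t).tape i z = .blank := by
  induction t with
  | zero =>
    have h₀ : (M.run w 0).tape i = wordTape [] := if_neg hi
    rw [h₀, wordTape_nil]
  | succ t ih =>
    push_cast at hz
    have hne : z ≠ (M.run w t).head i := by linarith [M.run_head_le w t i]
    rw [run_succ, step_tape_of_ne_head M hne, ih (by linarith)]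

theorem length_le_of_outputsIn {u : List Bool} {t : ℕ} (hlast : Fin.last M.k ≠ 0)
    (h : M.OutputsIn w u t) : u.length ≤ t := by
  by_contra! hlt
  have hblank := run_tape_eq_blank_of_le (M := M) (w := w) hlast (le_refl (t : ℤ))
  rw [h.2, wordTape_natCast, List.getElem?_eq_getElem hlt] at hblank
  cases hblank

theorem ReadOnlyInput.run_tape_zero (h : M.ReadOnlyInput) (t : ℕ) :
    (M.run w t).tape 0 = wordTape w := by
  induction t with
  | zero => rfl
  | succ t ih =>
    rw [run_succ]
    generalize M.run w t = c at ih
    rcases c with ⟨q | _ | _ | _, T, p⟩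
    · simp only [step, h.1, Function.update_eq_self]
      exact ih
    all_goals exact ih

theorem ReadOnlyInput.last_ne_zero (h : M.ReadOnlyInput) {u : List Bool} {t : ℕ}
    (hout : M.OutputsIn w u t) (huw : u ≠ w) : Fin.last M.k ≠ 0 := fun hlast =>
  huw (wordTape_injective (hout.2.symm.trans (hlast ▸ h.run_tape_zero t)))

end MultitapeTM

/-- Some machine works on every input `w` for at least `f |w|` and at most `O(|w| + f |w|)`
steps. -/
def HasTimer (f : ℕ → ℕ) : Prop :=
  ∃ (M : MultitapeTM) (c : ℕ), ∀ w : List Bool, ∃ t, M.LastStepAt w t ∧ f w.length ≤ t + 1 ∧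
    t + 1 ≤ c * (w.length + f w.length) + c

theorem IsProperComplexity.hasTimer {f : ℕ → ℕ} (hf : IsProperComplexity f) : HasTimer f := by
  obtain ⟨-, M, c, hro, hM⟩ := hf
  have hlast : Fin.last M.k ≠ 0 := by
    obtain ⟨t, -, hout, -⟩ := hM [false]
    refine hro.last_ne_zero hout fun h => ?_
    have hmem : false ∈ List.replicate (f [false].length) true := by
      rw [h]
      exact List.mem_singleton_self _
    cases List.eq_of_mem_replicate hmem
  refine ⟨M, c, fun w => ?_⟩
  obtain ⟨t, ht, hout, -⟩ := hM w
  have hhalt : ¬ (M.run w t).state.IsWork := by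
    rintro ⟨q, hq⟩
    cases hout.1.symm.trans hq
  obtain ⟨s, hst, hs⟩ := MultitapeTM.exists_lastStepAt hhalt
  have hout' : M.OutputsIn w (List.replicate (f w.length) true) (s + 1) := by
    rwa [MultitapeTM.OutputsIn, ← MultitapeTM.run_eq_of_le hs.2 hst]
  refine ⟨s, hs, ?_, by omega⟩
  simpa only [List.length_replicate] using MultitapeTM.length_le_of_outputsIn hlast hout'

/-- The states of the clock: counting the steps of `M`, or running down the odometer. -/
inductive ClockState (M : MultitapeTM) (d : ℕ) : Type
  | count (q : M.Q) (r : ZMod (d + 1))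
  | odometer (d₁ d₂ : Bool)

instance (M : MultitapeTM) (d : ℕ) : Finite (ClockState M d) :=
  have := M.finite_Q
  Finite.of_surjective (fun x : (M.Q × ZMod (d + 1)) ⊕ (Bool × Bool) => match x with
    | .inl (q, r) => ClockState.count q r
    | .inr (a, b) => .odometer a b) (by
    rintro (⟨q, r⟩ | ⟨a, b⟩)
    exacts [⟨.inl (q, r), rfl⟩, ⟨.inr (a, b), rfl⟩])

/-- The tapes of the clock: those of `M` and three counters. -/
abbrev ClockTape (M : MultitapeTM) : Type := Fin (M.k + 1) ⊕ Fin 3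

section CounterTape

variable {A : Type}

/-- A counter with `s` marks and its head at `x`. -/
def counterTape (s : ℕ) (x : ℤ) : ℤ → TapeSym A :=
  shiftTape (MultitapeTM.wordTape (List.replicate s true)) x

theorem counterTape_zero : (counterTape 0 0 : ℤ → TapeSym A) = MultitapeTM.wordTape [] :=
  shiftTape_zero _

theorem toOption_counterTape_ne_none (s : ℕ) (x : ℤ) :
    (counterTape s x 0 : TapeSym A).toOption ≠ none ↔ 0 ≤ x ∧ x < s := by
  rw [counterTape, shiftTape_apply_zero]
  rcases lt_or_ge x 0 with hx | hx
  · rw [MultitapeTM.wordTape_of_neg _ hx]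
    simp [TapeSym.toOption, hx]
  · obtain ⟨n, rfl⟩ := Int.eq_ofNat_of_zero_le hx
    rw [MultitapeTM.toOption_wordTape, List.getElem?_replicate]
    simp

theorem act_counterTape (s : ℕ) (x : ℤ) (m : HeadMove) :
    act (counterTape s x) (counterTape s x 0) m =
      (counterTape s (x + m.toInt) : ℤ → TapeSym A) := by
  rw [counterTape, shiftTape_apply_zero, act_shiftTape_self]
  rfl

theorem act_counterTape_mark (s : ℕ) :
    act (counterTape s s) (.bit true) .right =
      (counterTape (s + 1) ((s + 1 : ℕ) : ℤ) : ℤ → TapeSym A) := by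
  have h := MultitapeTM.act_shiftTape_wordTape (A := A) (List.replicate s true) true
  rw [List.length_replicate, ← List.replicate_succ'] at h
  exact_mod_cast h

/-- The position of a bouncing head that reaches the end of its `s` marks after `r` moves. -/
def bouncePos (s : ℕ) (right : Bool) (r : ℕ) : ℤ := if right then (s : ℤ) - r else (r : ℤ) - 1

theorem toOption_counterTape_bouncePos_ne_none {s r : ℕ} (hr : r ≤ s) (b : Bool) :
    (counterTape s (bouncePos s b r) 0 : TapeSym A).toOption ≠ none ↔ r ≠ 0 := by
  rw [toOption_counterTape_ne_none, bouncePos]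
  cases b <;> simp <;> omega

theorem act_counterTape_bouncePos (s : ℕ) (b : Bool) (r : ℕ) :
    act (counterTape s (bouncePos s b (r + 1))) (counterTape s (bouncePos s b (r + 1)) 0)
      (sweepMove b) = (counterTape s (bouncePos s b r) : ℤ → TapeSym A) := by
  rw [act_counterTape]
  congr 1
  cases b <;> simp [bouncePos, sweepMove, HeadMove.toInt] <;> ring

theorem act_counterTape_bouncePos_turn (s : ℕ) (b : Bool) :
    act (counterTape s (bouncePos s b 0)) (counterTape s (bouncePos s b 0) 0) (sweepMove !b) =
      (counterTape s (bouncePos s (!b) s) : ℤ → TapeSym A) := by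
  rw [act_counterTape]
  congr 1
  cases b <;> simp [bouncePos, sweepMove, HeadMove.toInt]; ring

end CounterTape

section Clock

variable (M : MultitapeTM) (d : ℕ)

/-- The clock writes one mark on each counter for every `d + 1` steps of `M`. When `M` halts, the
counter heads bounce between the ends of their marks; a head moves whenever the previous one is at
an end. -/
def clockTrans : TransFun (ClockState M d) (ClockTape M) M.A
  | .count q r, σ =>
    match M.δ q (σ ∘ Sum.inl) with
    | (.work q', a) => (.work (.count q' (r + 1)), Sum.elim a fun i =>
        if r + 1 = 0 then (.bit true, .right) else (σ (.inr i), .stay))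
    | (_, a) => (.work (.odometer false false), Sum.elim a fun i => (σ (.inr i), .left))
  | .odometer d₁ d₂, σ =>
    let out (s : Ctrl (ClockState M d)) (m₁ m₂ m₃ : HeadMove) :
        Ctrl (ClockState M d) × (ClockTape M → TapeSym M.A × HeadMove) :=
      (s, Sum.elim (fun i => (σ (.inl i), .stay))
        ![(σ (.inr 0), m₁), (σ (.inr 1), m₂), (σ (.inr 2), m₃)])
    if (σ (.inr 0)).toOption ≠ none then out (.work (.odometer d₁ d₂)) (sweepMove d₁) .stay .stay
    else if (σ (.inr 1)).toOption ≠ none then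
      out (.work (.odometer (!d₁) d₂)) (sweepMove !d₁) (sweepMove d₂) .stay
    else if (σ (.inr 2)).toOption ≠ none then
      out (.work (.odometer (!d₁) (!d₂))) (sweepMove !d₁) (sweepMove !d₂) .left
    else out .halt .stay .stay .stay

variable {M d}

/-- The odometer when `r₁`, `r₂`, `r₃` moves are left to its three heads. -/
def odometerConfig (T : Fin (M.k + 1) → ℤ → TapeSym M.A) (s : ℕ) (d₁ d₂ : Bool) (r₁ r₂ r₃ : ℕ) :
    ViewConfig (ClockState M d) (ClockTape M) M.A :=
  (.work (.odometer d₁ d₂), Sum.elim T ![counterTape s (bouncePos s d₁ r₁),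
    counterTape s (bouncePos s d₂ r₂), counterTape s (bouncePos s false r₃)])

theorem viewStep_odometer {T : Fin (M.k + 1) → ℤ → TapeSym M.A} {C₁ C₂ C₃ : ℤ → TapeSym M.A}
    {d₁ d₂ : Bool} {s : Ctrl (ClockState M d)} {m₁ m₂ m₃ : HeadMove}
    (h : clockTrans M d (.odometer d₁ d₂)
        (fun i => (Sum.elim T ![C₁, C₂, C₃] : ClockTape M → ℤ → TapeSym M.A) i 0) =
      (s, Sum.elim (fun i => (T i 0, .stay)) ![(C₁ 0, m₁), (C₂ 0, m₂), (C₃ 0, m₃)])) :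
    viewStep (clockTrans M d) (.work (.odometer d₁ d₂), Sum.elim T ![C₁, C₂, C₃]) =
      (s, Sum.elim T ![act C₁ (C₁ 0) m₁, act C₂ (C₂ 0) m₂, act C₃ (C₃ 0) m₃]) := by
  rw [viewStep_work, h]
  refine Prod.ext rfl (funext fun i => ?_)
  rcases i with i | i
  · exact act_stay_self (T i)
  · fin_cases i <;> rfl

section OdometerStep

variable (T : Fin (M.k + 1) → ℤ → TapeSym M.A) {s : ℕ} (d₁ d₂ : Bool)

theorem odometer_first {r₁ : ℕ} (r₂ r₃ : ℕ) (h₁ : r₁ + 1 ≤ s) :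
    viewStep (clockTrans M d) (odometerConfig T s d₁ d₂ (r₁ + 1) r₂ r₃) =
      odometerConfig T s d₁ d₂ r₁ r₂ r₃ := by
  have e₁ := (toOption_counterTape_bouncePos_ne_none (A := M.A) h₁ d₁).2 (by omega)
  rw [odometerConfig, viewStep_odometer (s := .work (.odometer d₁ d₂)) (m₁ := sweepMove d₁)
    (m₂ := .stay) (m₃ := .stay)]
  · simp only [act_counterTape_bouncePos, act_stay_self, odometerConfig]
  · exact (if_pos e₁).trans rfl

theorem odometer_second {r₂ : ℕ} (r₃ : ℕ) (h₂ : r₂ + 1 ≤ s) :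
    viewStep (clockTrans M d) (odometerConfig T s d₁ d₂ 0 (r₂ + 1) r₃) =
      odometerConfig T s (!d₁) d₂ s r₂ r₃ := by
  have e₁ := (toOption_counterTape_bouncePos_ne_none (A := M.A) (Nat.zero_le s) d₁).not.2 (by simp)
  have e₂ := (toOption_counterTape_bouncePos_ne_none (A := M.A) h₂ d₂).2 (by omega)
  rw [odometerConfig, viewStep_odometer (s := .work (.odometer (!d₁) d₂)) (m₁ := sweepMove !d₁)
    (m₂ := sweepMove d₂) (m₃ := .stay)]
  · simp only [act_counterTape_bouncePos, act_counterTape_bouncePos_turn, act_stay_self,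
      odometerConfig]
  · exact (if_neg e₁).trans ((if_pos e₂).trans rfl)

theorem odometer_third {r₃ : ℕ} (h₃ : r₃ + 1 ≤ s) :
    viewStep (clockTrans M d) (odometerConfig T s d₁ d₂ 0 0 (r₃ + 1)) =
      odometerConfig T s (!d₁) (!d₂) s s r₃ := by
  have e₁ := (toOption_counterTape_bouncePos_ne_none (A := M.A) (Nat.zero_le s) d₁).not.2 (by simp)
  have e₂ := (toOption_counterTape_bouncePos_ne_none (A := M.A) (Nat.zero_le s) d₂).not.2 (by simp)
  have e₃ := (toOption_counterTape_bouncePos_ne_none (A := M.A) h₃ false).2 (by omega)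
  rw [odometerConfig, viewStep_odometer (s := .work (.odometer (!d₁) (!d₂)))
    (m₁ := sweepMove !d₁) (m₂ := sweepMove !d₂) (m₃ := sweepMove false)]
  · simp only [act_counterTape_bouncePos, act_counterTape_bouncePos_turn, odometerConfig]
  · exact (if_neg e₁).trans ((if_neg e₂).trans ((if_pos e₃).trans rfl))

theorem odometer_end :
    (viewStep (clockTrans M d) (odometerConfig T s d₁ d₂ 0 0 0)).1 = .halt := by
  have e₁ := (toOption_counterTape_bouncePos_ne_none (A := M.A) (Nat.zero_le s) d₁).not.2 (by simp)
  have e₂ := (toOption_counterTape_bouncePos_ne_none (A := M.A) (Nat.zero_le s) d₂).not.2 (by simp)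
  have e₃ :=
    (toOption_counterTape_bouncePos_ne_none (A := M.A) (Nat.zero_le s) false).not.2 (by simp)
  rw [odometerConfig, viewStep_odometer (s := .halt) (m₁ := .stay) (m₂ := .stay) (m₃ := .stay)]
  exact (if_neg e₁).trans ((if_neg e₂).trans ((if_neg e₃).trans rfl))

variable {d₁ d₂}

-- The remaining moves are the digits, in base `s + 1`, of the remaining time.
theorem odometer_lastStepAt {V r₁ r₂ r₃ : ℕ} (h₁ : r₁ ≤ s) (h₂ : r₂ ≤ s) (h₃ : r₃ ≤ s)
    (hV : V = r₁ + (s + 1) * r₂ + (s + 1) ^ 2 * r₃) :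
    LastStepAt (clockTrans M d) (odometerConfig T s d₁ d₂ r₁ r₂ r₃) V := by
  induction V generalizing d₁ d₂ r₁ r₂ r₃ with
  | zero =>
    obtain ⟨⟨rfl, rfl⟩, rfl⟩ : (r₁ = 0 ∧ r₂ = 0) ∧ r₃ = 0 := by simpa using hV.symm
    refine ⟨⟨_, rfl⟩, ?_⟩
    rw [zero_add, Function.iterate_one, odometer_end]
    rintro ⟨q, hq⟩
    cases hq
  | succ V ih =>
    rcases r₁ with _ | r₁
    · rcases r₂ with _ | r₂
      · rcases r₃ with _ | r₃
        · simp at hV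
        · exact .of_iterate (s := 1) (odometer_third T d₁ d₂ h₃)
            (ih le_rfl le_rfl (by omega) (by nlinarith))
      · exact .of_iterate (s := 1) (odometer_second T d₁ d₂ r₃ h₂)
          (ih le_rfl (by omega) h₃ (by nlinarith))
    · exact .of_iterate (s := 1) (odometer_first T d₁ d₂ r₂ r₃ h₁)
        (ih (by omega) h₂ h₃ (by omega))

end OdometerStep

/-- The clock after `t` steps of `M`. -/
def countConfig (t : ℕ) (q : M.Q) (T : Fin (M.k + 1) → ℤ → TapeSym M.A) :
    ViewConfig (ClockState M d) (ClockTape M) M.A :=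
  (.work (.count q t), Sum.elim T fun _ => counterTape (t / (d + 1)) (t / (d + 1) : ℕ))

section Count

variable {q : M.Q} {T T' : Fin (M.k + 1) → ℤ → TapeSym M.A} {t : ℕ}

theorem viewStep_countConfig {q' : M.Q} (h : viewStep M.δ (.work q, T) = (.work q', T')) :
    viewStep (clockTrans M d) (countConfig t q T) = countConfig (t + 1) q' T' := by
  have hcarry : (t : ZMod (d + 1)) + 1 = 0 ↔ d + 1 ∣ t + 1 := by
    rw [← ZMod.natCast_eq_zero_iff, Nat.cast_succ]
  rcases hδ : M.δ q (fun i => T i 0) with ⟨_, a⟩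
  simp only [viewStep_work, hδ, Prod.mk.injEq] at h
  obtain ⟨rfl, rfl⟩ := h
  rw [countConfig, viewStep_work]
  simp only [clockTrans, Function.comp_def, Sum.elim_inl, hδ, hcarry]
  refine Prod.ext (by simp [countConfig]) (funext fun i => ?_)
  rcases i with i | i
  · rfl
  · simp only [countConfig, Sum.elim_inr, Nat.succ_div]
    split_ifs
    · exact act_counterTape_mark _
    · exact act_stay_self _

theorem viewStep_countConfig_of_not_isWork (h : ¬ (viewStep M.δ (.work q, T)).1.IsWork) :
    viewStep (clockTrans M d) (countConfig t q T) =
      odometerConfig (viewStep M.δ (.work q, T)).2 (t / (d + 1)) false false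
        (t / (d + 1)) (t / (d + 1)) (t / (d + 1)) := by
  rcases hδ : M.δ q (fun i => T i 0) with ⟨c, a⟩
  simp only [countConfig, viewStep_work, hδ, clockTrans, Function.comp_def, Sum.elim_inl] at h ⊢
  rcases c with p | _ | _ | _
  · exact absurd ⟨p, rfl⟩ h
  all_goals
    refine Prod.ext rfl (funext fun i => ?_)
    rcases i with i | i
    · rfl
    · refine (act_counterTape _ _ .left).trans ?_
      fin_cases i <;> rfl

theorem iterate_countConfig {q₀ : M.Q} {T₀ : Fin (M.k + 1) → ℤ → TapeSym M.A}
    (h : (viewStep M.δ)^[t] (.work q₀, T₀) = (.work q, T)) :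
    (viewStep (clockTrans M d))^[t] (countConfig 0 q₀ T₀) = countConfig t q T := by
  induction t generalizing q T with
  | zero => cases h; rfl
  | succ t ih =>
    obtain ⟨q', hq'⟩ := isWork_of_le ⟨q, congrArg Prod.fst h⟩ (Nat.le_succ t)
    have hc : (viewStep M.δ)^[t] (.work q₀, T₀) = (.work q', _) := Prod.ext hq' rfl
    rw [Function.iterate_succ_apply', hc] at h
    rw [Function.iterate_succ_apply', ih hc, viewStep_countConfig h]

end Count

variable (M d)

/-- The last working time of the clock on an input on which `M` last works at time `t`. -/
def clockTime (t : ℕ) : ℕ := t + (t / (d + 1) + 1) ^ 3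

/-- The initial configuration of the clock. -/
def clockStart (w : List Bool) : ViewConfig (ClockState M d) (ClockTape M) M.A :=
  countConfig 0 M.start (M.init w).view.2

variable {M}

theorem clock_lastStepAt {w : List Bool} {t : ℕ} (h : M.LastStepAt w t) :
    LastStepAt (clockTrans M d) (clockStart M d w) (clockTime d t) := by
  rw [clockTime]
  obtain ⟨⟨q, hq⟩, hhalt⟩ := MultitapeTM.lastStepAt_iff.1 h
  obtain ⟨T, hT⟩ : ∃ T, (viewStep M.δ)^[t] (M.init w).view = (.work q, T) :=
    ⟨_, Prod.ext hq rfl⟩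
  rw [Function.iterate_succ_apply', hT] at hhalt
  have hcount : (viewStep (clockTrans M d))^[t] (clockStart M d w) = countConfig t q T :=
    iterate_countConfig hT
  set s := t / (d + 1)
  have hturn : (viewStep (clockTrans M d))^[t + 1] (clockStart M d w) =
      odometerConfig (viewStep M.δ (.work q, T)).2 s false false s s s := by
    rw [Function.iterate_succ_apply', hcount]
    exact viewStep_countConfig_of_not_isWork hhalt
  have hpos : 1 ≤ (s + 1) ^ 3 := Nat.one_le_pow _ _ s.succ_pos
  have hvalue : (s + 1) ^ 3 - 1 = s + (s + 1) * s + (s + 1) ^ 2 * s := by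
    rw [Nat.sub_eq_iff_eq_add hpos]
    ring
  convert LastStepAt.of_iterate hturn
    (odometer_lastStepAt _ le_rfl le_rfl le_rfl hvalue) using 1
  omega

end Clock

/-! ### Running two machines in parallel -/

section Parallel

variable {Q₁ Q₂ ι₁ ι₂ A : Type}

/-- The control state of two machines run in parallel: the second one answers, the first one may
interrupt it, and the answer is then `no`. -/
def Ctrl.parallel : Ctrl Q₁ → Ctrl Q₂ → Ctrl (Q₁ × Q₂)
  | .work q₁, .work q₂ => .work (q₁, q₂)
  | _, .yes => .yes
  | _, _ => .no

theorem Ctrl.exists_parallel_eq_answer_of_left {s₁ : Ctrl Q₁} (h : ¬ s₁.IsWork) (s₂ : Ctrl Q₂) :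
    ∃ b, s₁.parallel s₂ = .answer b := by
  rcases s₁ with q | _ | _ | _
  · exact absurd ⟨q, rfl⟩ h
  all_goals
    rcases s₂ with _ | _ | _ | _
    exacts [⟨false, rfl⟩, ⟨true, rfl⟩, ⟨false, rfl⟩, ⟨false, rfl⟩]

theorem Ctrl.exists_parallel_eq_answer_of_right (s₁ : Ctrl Q₁) {s₂ : Ctrl Q₂} (h : ¬ s₂.IsWork) :
    ∃ b, s₁.parallel s₂ = .answer b := by
  rcases s₂ with q | _ | _ | _
  · exact absurd ⟨q, rfl⟩ h
  · exact ⟨true, by cases s₁ <;> rfl⟩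
  all_goals exact ⟨false, by cases s₁ <;> rfl⟩

theorem Ctrl.parallel_answer (s₁ : Ctrl Q₁) (b : Bool) :
    s₁.parallel (.answer b : Ctrl Q₂) = .answer b := by
  cases b <;> cases s₁ <;> rfl

/-- Two machines on disjoint sets of tapes run in parallel. -/
def parallelTrans (δ₁ : TransFun Q₁ ι₁ A) (δ₂ : TransFun Q₂ ι₂ A) :
    TransFun (Q₁ × Q₂) (ι₁ ⊕ ι₂) A := fun q σ =>
  ((δ₁ q.1 (σ ∘ Sum.inl)).1.parallel (δ₂ q.2 (σ ∘ Sum.inr)).1,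
    Sum.elim (δ₁ q.1 (σ ∘ Sum.inl)).2 (δ₂ q.2 (σ ∘ Sum.inr)).2)

/-- A pair of configurations. -/
def pairConfig (c₁ : ViewConfig Q₁ ι₁ A) (c₂ : ViewConfig Q₂ ι₂ A) :
    ViewConfig (Q₁ × Q₂) (ι₁ ⊕ ι₂) A :=
  (c₁.1.parallel c₂.1, Sum.elim c₁.2 c₂.2)

variable {δ₁ : TransFun Q₁ ι₁ A} {δ₂ : TransFun Q₂ ι₂ A}
  {c₁ : ViewConfig Q₁ ι₁ A} {c₂ : ViewConfig Q₂ ι₂ A} {t : ℕ}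

theorem viewStep_pairConfig (h₁ : c₁.1.IsWork) (h₂ : c₂.1.IsWork) :
    viewStep (parallelTrans δ₁ δ₂) (pairConfig c₁ c₂) =
      pairConfig (viewStep δ₁ c₁) (viewStep δ₂ c₂) := by
  rcases c₁ with ⟨_, T₁⟩
  rcases c₂ with ⟨_, T₂⟩
  obtain ⟨q₁, rfl⟩ := h₁
  obtain ⟨q₂, rfl⟩ := h₂
  refine Prod.ext rfl (funext fun i => ?_)
  rcases i with i | i <;> rfl

theorem iterate_succ_pairConfig (h₁ : ((viewStep δ₁)^[t] c₁).1.IsWork)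
    (h₂ : ((viewStep δ₂)^[t] c₂).1.IsWork) :
    (viewStep (parallelTrans δ₁ δ₂))^[t + 1] (pairConfig c₁ c₂) =
      pairConfig ((viewStep δ₁)^[t + 1] c₁) ((viewStep δ₂)^[t + 1] c₂) := by
  induction t with
  | zero => exact viewStep_pairConfig h₁ h₂
  | succ t ih =>
    have hpair := ih (isWork_of_le h₁ t.le_succ) (isWork_of_le h₂ t.le_succ)
    rw [Function.iterate_succ_apply', hpair, viewStep_pairConfig h₁ h₂,
      ← Function.iterate_succ_apply' (viewStep δ₁), ← Function.iterate_succ_apply' (viewStep δ₂)]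

theorem AnswersWithin.parallel {b : Bool} (h₁ : ((viewStep δ₁)^[t] c₁).1.IsWork)
    (h₂ : c₂.1.IsWork) (hb : AnswersWithin δ₂ c₂ t b) :
    AnswersWithin (parallelTrans δ₁ δ₂) (pairConfig c₁ c₂) (t + 1) b := by
  obtain ⟨s, hst, hs, hs'⟩ := exists_lastStepAt h₂ hb.not_isWork
  suffices AnswersWithin (parallelTrans δ₁ δ₂) (pairConfig c₁ c₂) (s + 1) b from
    this.mono (by omega)
  have hanswer : ((viewStep δ₂)^[s + 1] c₂).1 = .answer b := by
    rw [← viewStep_iterate_eq_of_le hs' hst, hb]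
  rw [AnswersWithin, iterate_succ_pairConfig (isWork_of_le h₁ hst.le) hs, pairConfig, hanswer,
    Ctrl.parallel_answer]

theorem exists_answersWithin_parallel (h₁ : LastStepAt δ₁ c₁ t) (h₂ : c₂.1.IsWork) :
    ∃ b, AnswersWithin (parallelTrans δ₁ δ₂) (pairConfig c₁ c₂) (t + 1) b := by
  by_cases ht : ((viewStep δ₂)^[t] c₂).1.IsWork
  · simp only [AnswersWithin, iterate_succ_pairConfig h₁.1 ht]
    exact Ctrl.exists_parallel_eq_answer_of_left h₁.2 _
  · obtain ⟨s, hst, hs, hs'⟩ := exists_lastStepAt h₂ ht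
    have hpair := iterate_succ_pairConfig (isWork_of_le h₁.1 hst.le) hs
    obtain ⟨b, hb⟩ :=
      Ctrl.exists_parallel_eq_answer_of_right ((viewStep δ₁)^[s + 1] c₁).1 hs'
    have hsb : AnswersWithin (parallelTrans δ₁ δ₂) (pairConfig c₁ c₂) (s + 1) b := by
      rw [AnswersWithin, hpair, pairConfig, hb]
    exact ⟨b, hsb.mono (by omega)⟩

end Parallel

/-! ### Copying the input -/

/-- The states of a machine that first copies its input. -/
inductive CopyState (Q : Type) : Type
  | copy
  | back
  | main (q : Q)

instance {Q : Type} [Finite Q] : Finite (CopyState Q) :=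
  Finite.of_surjective (fun x : Bool ⊕ Q => match x with
    | .inl false => CopyState.copy
    | .inl true => .back
    | .inr q => .main q) (by
    rintro (_ | _ | q)
    exacts [⟨.inl false, rfl⟩, ⟨.inl true, rfl⟩, ⟨.inr q, rfl⟩])

section Copy

variable {Q ι A : Type}

/-- The control state in which a main program goes on. -/
def Ctrl.toMain : Ctrl Q → Ctrl (CopyState Q)
  | .work q => .work (.main q)
  | .yes => .yes
  | .no => .no
  | .halt => .halt

theorem Ctrl.toMain_answer (b : Bool) : (Ctrl.answer b : Ctrl Q).toMain = .answer b := by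
  cases b <;> rfl

/-- Copy the input from the tape `i₀` to the tapes selected by `tr`, rewind, then start `δ`. -/
def copyTrans (i₀ : ι) (tr : ι → Bool) (q₀ : Q) (δ : TransFun Q ι A) :
    TransFun (CopyState Q) ι A
  | .copy, σ =>
    match (σ i₀).toOption with
    | some b => (.work .copy, fun i => if tr i then (.bit b, .right) else (σ i, .stay))
    | none => (.work .back, fun i => (σ i, if tr i then .left else .stay))
  | .back, σ =>
    match (σ i₀).toOption with
    | some _ => (.work .back, fun i => (σ i, if tr i then .left else .stay))
    | none => (.work (.main q₀), fun i => (σ i, if tr i then .right else .stay))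
  | .main q, σ => ((δ q σ).1.toMain, (δ q σ).2)

variable {i₀ : ι} {tr : ι → Bool} {q₀ : Q} {δ : TransFun Q ι A} {w : List Bool}

/-- The tapes with the word `u` and the head at `x` on the selected tapes. -/
def trackedTapes (tr : ι → Bool) (u : List Bool) (x : ℤ) (i : ι) : ℤ → TapeSym A :=
  if tr i then shiftTape (MultitapeTM.wordTape u) x else MultitapeTM.wordTape []

theorem act_trackedTapes (u : List Bool) (x : ℤ) (m : HeadMove) (i : ι) :
    act (trackedTapes tr u x i) (trackedTapes tr u x i 0) (if tr i then m else .stay) =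
      (trackedTapes tr u (x + m.toInt) i : ℤ → TapeSym A) := by
  unfold trackedTapes
  split_ifs
  · rw [shiftTape_apply_zero, act_shiftTape_self]
  · exact act_stay_self _

theorem toOption_trackedTapes (h₀ : tr i₀) (w : List Bool) (x : ℤ) :
    (trackedTapes tr w x i₀ 0 : TapeSym A).toOption =
      (MultitapeTM.wordTape w x : TapeSym A).toOption := by
  rw [trackedTapes, if_pos h₀, shiftTape_apply_zero]

/-- The tapes when the first `j` letters of `w` have been copied. -/
def copyTapes [DecidableEq ι] (i₀ : ι) (tr : ι → Bool) (w : List Bool) (j : ℕ) (i : ι) :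
    ℤ → TapeSym A :=
  if i = i₀ then shiftTape (MultitapeTM.wordTape w) j else trackedTapes tr (w.take j) j i

theorem copyTapes_zero [DecidableEq ι] :
    (copyTapes i₀ tr w 0 : ι → ℤ → TapeSym A) =
      fun i => if i = i₀ then MultitapeTM.wordTape w else MultitapeTM.wordTape [] := by
  funext i
  simp [copyTapes, trackedTapes, shiftTape_zero]

theorem copyTapes_length [DecidableEq ι] (h₀ : tr i₀) :
    (copyTapes i₀ tr w w.length : ι → ℤ → TapeSym A) = trackedTapes tr w w.length := by
  funext i
  by_cases hi : i = i₀
  · subst hi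
    simp [copyTapes, trackedTapes, h₀]
  · simp [copyTapes, hi]

theorem viewStep_copyTapes [DecidableEq ι] (h₀ : tr i₀) {j : ℕ} (hj : j < w.length) :
    viewStep (copyTrans i₀ tr q₀ δ) (.work .copy, copyTapes i₀ tr w j) =
      (.work .copy, copyTapes i₀ tr w (j + 1)) := by
  have hsym : (MultitapeTM.wordTape w (j : ℤ) : TapeSym A) = .bit w[j] := by
    rw [MultitapeTM.wordTape_natCast, List.getElem?_eq_getElem hj]
    rfl
  have hscan : (copyTapes i₀ tr w j i₀ 0 : TapeSym A) = .bit w[j] := by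
    rw [copyTapes, if_pos rfl, shiftTape_apply_zero, hsym]
  rw [viewStep_work]
  simp only [copyTrans, hscan, TapeSym.toOption]
  refine Prod.ext rfl (funext fun i => ?_)
  by_cases hi : i = i₀
  · subst hi
    simp only [copyTapes, if_true, h₀, ← hsym, act_shiftTape_self]
    push_cast
    rfl
  · simp only [copyTapes, if_neg hi, trackedTapes]
    split_ifs
    · have h := MultitapeTM.act_shiftTape_wordTape (A := A) (w.take j) w[j]
      rw [List.length_take, min_eq_left hj.le, List.take_append_getElem hj] at h
      rw [h]
      push_cast
      rfl
    · exact act_stay_self _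

theorem copy_forward [DecidableEq ι] (h₀ : tr i₀) {j : ℕ} (hj : j ≤ w.length) :
    (viewStep (copyTrans i₀ tr q₀ δ))^[j] (.work .copy, copyTapes i₀ tr w 0) =
      (.work .copy, copyTapes i₀ tr w j) := by
  induction j with
  | zero => rfl
  | succ j ih => rw [Function.iterate_succ_apply', ih (by omega), viewStep_copyTapes h₀ hj]

theorem copy_turn (h₀ : tr i₀) :
    viewStep (copyTrans i₀ tr q₀ δ) (.work .copy, trackedTapes tr w w.length) =
      (.work .back, trackedTapes tr w (w.length - 1 : ℤ)) := by
  have hscan : (trackedTapes tr w w.length i₀ 0 : TapeSym A).toOption = none := by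
    rw [toOption_trackedTapes h₀, MultitapeTM.wordTape_of_length_le w le_rfl]
    rfl
  rw [viewStep_work]
  simp only [copyTrans, hscan, act_trackedTapes]
  rfl

theorem copy_back (h₀ : tr i₀) {p : ℕ} (hp : p ≤ w.length) :
    (viewStep (copyTrans i₀ tr q₀ δ))^[p] (.work .back, trackedTapes tr w (p - 1 : ℤ)) =
      (.work .back, trackedTapes tr w (-1)) := by
  induction p with
  | zero => rfl
  | succ p ih =>
    have hscan : (trackedTapes tr w (p : ℤ) i₀ 0 : TapeSym A).toOption = some w[p] := by
      rw [toOption_trackedTapes h₀, MultitapeTM.toOption_wordTape, List.getElem?_eq_getElem hp]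
    rw [Function.iterate_succ_apply, Nat.cast_succ, add_sub_cancel_right, viewStep_work]
    simp only [copyTrans, hscan, act_trackedTapes]
    exact ih (by omega)

theorem copy_end (h₀ : tr i₀) :
    viewStep (copyTrans i₀ tr q₀ δ) (.work .back, trackedTapes tr w (-1)) =
      (.work (.main q₀), trackedTapes tr w 0) := by
  have hscan : (trackedTapes tr w (-1) i₀ 0 : TapeSym A).toOption = none := by
    rw [toOption_trackedTapes h₀, MultitapeTM.wordTape_of_neg w (by omega)]
    rfl
  rw [viewStep_work]
  simp only [copyTrans, hscan, act_trackedTapes]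
  rfl

theorem copy_run [DecidableEq ι] (h₀ : tr i₀) :
    (viewStep (copyTrans i₀ tr q₀ δ))^[2 * w.length + 2]
      (.work .copy, fun i => if i = i₀ then MultitapeTM.wordTape w else MultitapeTM.wordTape []) =
      (.work (.main q₀), trackedTapes tr w 0) := by
  rw [← copyTapes_zero (tr := tr), ← copy_end h₀, ← copy_back h₀ le_rfl, ← copy_turn h₀,
    ← copyTapes_length h₀, ← copy_forward h₀ le_rfl, ← Function.iterate_succ_apply,
    ← Function.iterate_add_apply, ← Function.iterate_succ_apply' (viewStep _)]
  congr 2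
  omega

theorem iterate_copyTrans_main (c : ViewConfig Q ι A) (t : ℕ) :
    (viewStep (copyTrans i₀ tr q₀ δ))^[t] (c.1.toMain, c.2) =
      (((viewStep δ)^[t] c).1.toMain, ((viewStep δ)^[t] c).2) := by
  have hs : Function.Semiconj (fun c : ViewConfig Q ι A => (c.1.toMain, c.2)) (viewStep δ)
      (viewStep (copyTrans i₀ tr q₀ δ)) := by
    rintro ⟨_ | _ | _ | _, T⟩ <;> rfl
  exact (hs.iterate_right t c).symm

theorem AnswersWithin.copy [DecidableEq ι] (h₀ : tr i₀) {t : ℕ} {b : Bool}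
    (h : AnswersWithin δ (.work q₀, trackedTapes tr w 0) t b) :
    AnswersWithin (copyTrans i₀ tr q₀ δ)
      (.work .copy, fun i => if i = i₀ then MultitapeTM.wordTape w else MultitapeTM.wordTape [])
      (t + (2 * w.length + 2)) b := by
  refine .of_iterate (copy_run h₀) ?_
  have hmain := iterate_copyTrans_main (i₀ := i₀) (tr := tr) (q₀ := q₀) (δ := δ)
    (.work q₀, trackedTapes tr w 0) t
  rw [h, Ctrl.toMain_answer] at hmain
  exact congrArg Prod.fst hmain

end Copy

/-! ### The diagonal machine -/

namespace MultitapeTM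

variable {M : MultitapeTM} {w : List Bool} {t : ℕ} {b : Bool}

theorem answersWithin_ofTrans {Q ι A : Type} [Finite A] [Finite Q] [DecidableEq ι] {k : ℕ}
    {e : ι ≃ Fin (k + 1)} {i₀ : ι} (he : e i₀ = 0) {q₀ : Q} {δ : TransFun Q ι A} :
    (ofTrans e q₀ δ).AnswersWithin w t b ↔ _root_.AnswersWithin δ
      (.work q₀, fun i => if i = i₀ then wordTape w else wordTape []) t b := by
  have hi : ∀ i, e i = 0 ↔ i = i₀ := fun i => by rw [← he, e.injective.eq_iff]
  rw [AnswersWithin, run_ofTrans_state]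
  simp only [hi]
  rfl

/-- The language accepted by a machine. -/
def language (M : MultitapeTM) : Language Bool := {w | ∃ t, M.AcceptsIn w t}

theorem AnswersWithin.mem_language_iff (h : M.AnswersWithin w t b) :
    w ∈ M.language ↔ b = true := by
  constructor
  · rintro ⟨s, hs : M.AnswersWithin w s true⟩
    exact Ctrl.answer_injective
      ((h.mono (le_max_right s t)).symm.trans (hs.mono (le_max_left s t)))
  · rintro rfl
    exact ⟨t, h⟩

theorem AnswersWithin.decidesIn_language (h : M.AnswersWithin w t b) :
    M.DecidesIn M.language w t := by
  cases b
  · exact .inr ⟨by simp [h.mem_language_iff], h⟩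
  · exact .inl ⟨h.mem_language_iff.2 rfl, h⟩

theorem DecidesIn.exists_answersWithin {L : Language Bool} (h : M.DecidesIn L w t) :
    ∃ b, M.AnswersWithin w t b ∧ (w ∈ L ↔ b = true) := by
  rcases h with ⟨hL, h⟩ | ⟨hL, h⟩
  · exact ⟨true, h, by simp [hL]⟩
  · exact ⟨false, h, by simp [hL]⟩

end MultitapeTM

/-- The tapes holding the input after the copying phase. -/
def inputTracks (M : MultitapeTM) : ClockTape M ⊕ InterpTape → Bool
  | .inl (.inl i) => decide (i = 0)
  | .inr .prog => true
  | .inr .inp => true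
  | _ => false

theorem pairConfig_start (M : MultitapeTM) (d : ℕ) (w : List Bool) :
    pairConfig (clockStart M d w) (interpStart w) =
      (.work (.count M.start 0, .rewind), trackedTapes (inputTracks M) w 0) := by
  refine Prod.ext (by simp [pairConfig, clockStart, countConfig, Ctrl.parallel, interpStart,
    interpConfig]) (funext fun i => ?_)
  rcases i with (i | i) | i
  · simp [pairConfig, clockStart, countConfig, MultitapeTM.view_init, trackedTapes, inputTracks,
      shiftTape_zero]
  · exact (congrArg (fun s : ℕ => counterTape s s) (Nat.zero_div _)).trans counterTape_zero
  · cases i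
    · rfl
    · rfl
    · exact (MultitapeTM.wordTape_eq_splitTape []).symm
    · exact (funext fun z => MultitapeTM.wordTape_nil z).symm

/-- The time in which the interpreter, run against the clock after copying an input of length `n`,
answers. -/
def answerTime (d n t : ℕ) : ℕ := clockTime d t + 1 + (2 * n + 2)

theorem exists_clocked_interpreter (M : MultitapeTM) (d : ℕ) :
    ∃ U : MultitapeTM, ∀ {w : List Bool} {t : ℕ}, M.LastStepAt w t →
      (∃ b, U.AnswersWithin w (answerTime d w.length t) b) ∧
      ∀ b, AnswersWithin interpTrans (interpStart w : ViewConfig InterpState InterpTape M.A)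
        (clockTime d t) b → U.AnswersWithin w (answerTime d w.length t) b := by
  classical
  have := M.finite_A
  let i₀ : ClockTape M ⊕ InterpTape := .inl (.inl 0)
  have h₀ : inputTracks M i₀ := by simp [inputTracks, i₀]
  obtain ⟨k, e, he⟩ := exists_equiv_fin_map_zero i₀
  let δ := parallelTrans (clockTrans M d) (interpTrans (A := M.A))
  refine ⟨MultitapeTM.ofTrans e .copy
    (copyTrans i₀ (inputTracks M) (.count M.start 0, .rewind) δ), fun {w t} ht => ?_⟩
  have hclock := clock_lastStepAt d ht
  have hinterp : (interpStart w : ViewConfig InterpState InterpTape M.A).1.IsWork := ⟨_, rfl⟩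
  simp only [MultitapeTM.answersWithin_ofTrans he]
  obtain ⟨b, hb⟩ := exists_answersWithin_parallel (δ₂ := interpTrans) hclock hinterp
  refine ⟨⟨b, ?_⟩, fun b' hb' => ?_⟩
  · rw [pairConfig_start] at hb
    exact hb.copy h₀
  · have hpair := hb'.parallel hclock.1 hinterp
    rw [pairConfig_start] at hpair
    exact hpair.copy h₀

theorem answerTime_le_cube {c n F t : ℕ} (hn : n ≤ F) (hF : 3 * c + 8 ≤ F)
    (ht : t + 1 ≤ c * (n + F) + c) : answerTime (8 * c + 7) n t ≤ F ^ 3 := by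
  unfold answerTime clockTime
  set s := t / (8 * c + 7 + 1)
  have hs : 8 * s ≤ 2 * F + 1 := by
    have hst : (8 * c + 7 + 1) * s ≤ t := Nat.mul_div_le t _
    have hscaled : (c + 1) * (8 * s) ≤ (c + 1) * (2 * F + 1) := by nlinarith
    exact Nat.le_of_mul_le_mul_left hscaled c.succ_pos
  have hodometer : 8 * (s + 1) ^ 3 ≤ F ^ 3 := by
    calc 8 * (s + 1) ^ 3 = (2 * (s + 1)) ^ 3 := by ring
      _ ≤ F ^ 3 := Nat.pow_le_pow_left (by omega) 3
  have hlinear : 8 * (t + 1 + (2 * n + 2)) ≤ F ^ 3 := by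
    calc 8 * (t + 1 + (2 * n + 2)) ≤ 8 * ((3 * c + 8) * F) := by nlinarith
      _ ≤ F * (F * F) := by gcongr; omega
      _ = F ^ 3 := by ring
  omega

theorem quadratic_le_clockTime {d Z C F t : ℕ} (hF : (d + 1) ^ 3 * Z * (C + 1) ^ 2 + 1 ≤ F)
    (ht : F ≤ t + 1) : Z * (C * F + 1) ^ 2 ≤ clockTime d t := by
  refine le_add_left (Nat.le_of_mul_le_mul_left ?_ (pow_pos d.succ_pos 3))
  calc (d + 1) ^ 3 * (Z * (C * F + 1) ^ 2) ≤ (d + 1) ^ 3 * (Z * (C * F + F) ^ 2) := by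
        gcongr; omega
    _ = (d + 1) ^ 3 * Z * (C + 1) ^ 2 * F ^ 2 := by ring
    _ ≤ F * F ^ 2 := by gcongr; omega
    _ = F ^ 3 := by ring
    _ ≤ ((d + 1) * (t / (d + 1) + 1)) ^ 3 := by
        gcongr
        exact ht.trans (Nat.lt_mul_div_succ t d.succ_pos)
    _ = (d + 1) ^ 3 * (t / (d + 1) + 1) ^ 3 := mul_pow _ _ _

/-! ### Density of words with a given prefix -/

theorem ncard_length_eq (n : ℕ) : {w : List Bool | w.length = n}.ncard = 2 ^ n := by
  rw [← Fintype.card_bool, ← card_vector, ← Nat.card_eq_fintype_card]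
  rfl

theorem finite_wordBall (n : ℕ) : (wordBall n).Finite := List.finite_length_le Bool n

theorem ncard_wordBall_lt (n : ℕ) : (wordBall n).ncard < 2 ^ (n + 1) := by
  induction n with
  | zero =>
    have hball : wordBall 0 = {w : List Bool | w.length = 0} := by
      ext w; simp [wordBall]
    rw [hball, ncard_length_eq]
    norm_num
  | succ n ih =>
    have hball : wordBall (n + 1) = wordBall n ∪ {w : List Bool | w.length = n + 1} := by
      ext w
      simp only [wordBall, Set.mem_ofPred_eq, Set.mem_union]
      omega
    have hunion := Set.ncard_union_le (wordBall n) {w : List Bool | w.length = n + 1}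
    rw [← hball, ncard_length_eq] at hunion
    rw [pow_succ 2 (n + 1)]
    omega

section Prefix

variable {S : Set (List Bool)} {u : List Bool} {N n : ℕ}

theorem ncard_inter_wordBall_add_le (h : ∀ v : List Bool, N ≤ v.length → u ++ v ∉ S)
    (hn : N + u.length ≤ n) :
    (S ∩ wordBall n).ncard + 2 ^ (n - u.length) ≤ (wordBall n).ncard := by
  let P : Set (List Bool) := (u ++ ·) '' {v | v.length = n - u.length}
  have hcard : P.ncard = 2 ^ (n - u.length) := by
    rw [Set.ncard_image_of_injective _ (List.append_right_injective u), ncard_length_eq]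
  have hball : P ⊆ wordBall n := by
    rintro _ ⟨v, hv, rfl⟩
    simp only [Set.mem_ofPred_eq] at hv
    simp only [wordBall, Set.mem_ofPred_eq, List.length_append]
    omega
  have hdisj : Disjoint (S ∩ wordBall n) P := by
    rw [Set.disjoint_right]
    rintro _ ⟨v, hv, rfl⟩ hmem
    simp only [Set.mem_ofPred_eq] at hv
    exact h v (by omega) hmem.1
  rw [← hcard, ← Set.ncard_union_eq hdisj ((finite_wordBall n).subset Set.inter_subset_right)
    ((finite_wordBall n).subset hball)]
  exact Set.ncard_le_ncard (Set.union_subset Set.inter_subset_right hball) (finite_wordBall n)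

theorem wordDensity_le_of_prefix (h : ∀ v : List Bool, N ≤ v.length → u ++ v ∉ S)
    (hn : N + u.length ≤ n) : wordDensity S n ≤ 1 - 1 / 2 ^ (u.length + 1) := by
  have hcard : ((S ∩ wordBall n).ncard : ℝ) + 2 ^ (n - u.length) ≤ (wordBall n).ncard := by
    exact_mod_cast ncard_inter_wordBall_add_le h hn
  have hball : ((wordBall n).ncard : ℝ) ≤ 2 ^ (u.length + 1) * 2 ^ (n - u.length) := by
    rw [← pow_add, show u.length + 1 + (n - u.length) = n + 1 by omega]
    exact_mod_cast (ncard_wordBall_lt n).le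
  have hpos : (0 : ℝ) < (wordBall n).ncard := lt_of_lt_of_le (by positivity) hcard
  have hprefix : 1 / 2 ^ (u.length + 1) * ((wordBall n).ncard : ℝ) ≤ 2 ^ (n - u.length) := by
    rwa [one_div, inv_mul_le_iff₀ (by positivity)]
  rw [wordDensity, div_le_iff₀ hpos]
  linarith

theorem not_isGeneric_of_prefix (h : ∀ v : List Bool, N ≤ v.length → u ++ v ∉ S) :
    ¬ IsGeneric S := fun hS => by
  have hle : (1 : ℝ) ≤ 1 - 1 / 2 ^ (u.length + 1) := le_of_tendsto hS
    ((eventually_ge_atTop (N + u.length)).mono fun _ => wordDensity_le_of_prefix h)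
  have hpos : (0 : ℝ) < 1 / 2 ^ (u.length + 1) := by positivity
  linarith

end Prefix

/-! ### The hierarchy theorem -/

theorem theorem9p3_general (f : ℕ → ℕ) (hf : HasTimer f) (hfn : ∀ n, n ≤ f n) :
    ∃ L : Language Bool, ComputableInTime L (fun n => f n ^ 3) ∧
      ∀ C : ℕ, ¬ GenericallyComputableInTime L (fun n => C * f n) := by
  obtain ⟨M, c, hM⟩ := hf
  obtain ⟨U, hU⟩ := exists_clocked_interpreter M (8 * c + 7)
  refine ⟨U.language, ⟨U, fun w => ?_, 3 * c + 8, fun w hw => ?_⟩, fun C => ?_⟩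
  · obtain ⟨t, hlast, -⟩ := hM w
    obtain ⟨⟨b, hb⟩, -⟩ := hU hlast
    exact ⟨_, hb.decidesIn_language⟩
  · obtain ⟨t, hlast, -, ht⟩ := hM w
    obtain ⟨⟨b, hb⟩, -⟩ := hU hlast
    exact (hb.mono (answerTime_le_cube (hfn _) (hw.trans (hfn _)) ht)).decidesIn_language
  · rintro ⟨M', hgen⟩
    obtain ⟨u, Z, hu⟩ := M'.exists_program
    refine not_isGeneric_of_prefix (u := u) (N := (8 * c + 7 + 1) ^ 3 * Z * (C + 1) ^ 2 + 1)
      (fun v hv hmem => ?_) hgen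
    obtain ⟨b, hb, hL⟩ := MultitapeTM.DecidesIn.exists_answersWithin hmem
    obtain ⟨t, hlast, hft, -⟩ := hM (u ++ v)
    have hlong : v.length ≤ f (u ++ v).length := le_trans (by simp) (hfn _)
    have hopposite : U.AnswersWithin (u ++ v) _ !b :=
      (hU hlast).2 _ ((hu M.A v _ b hb).mono (quadratic_le_clockTime (hv.trans hlong) hft))
    rw [hopposite.mem_language_iff] at hL
    cases b <;> simp at hL

theorem theorem9p3 (f : ℕ → ℕ) (hf : IsProperComplexity f) (hfn : ∀ n, n ≤ f n) :
    ∃ L : Language Bool, ComputableInTime L (fun n => f n ^ 3) ∧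
      ∀ C : ℕ, ¬ GenericallyComputableInTime L (fun n => C * f n) :=
  theorem9p3_general f hf.hasTimer hfn
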